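/- Let $k,m,n\ge 1$ be integers and let $f,g\in L^\infty(\mathbb R^k)$ be real valued. Put $r_\infty:=\|f\|_\infty\|g\|_\infty$. Notation. $\gamma_k$ is the standard Gaussian measure on $\mathbb R^k$. For $\alpha\in\mathbb N_0^k$ let $H_\alpha(x)=\prod_{i=1}^k \frac{1}{\sqrt{\alpha_i!}}\mathrm{He}_{\alpha_i}(x_i)$, with $\mathrm{He}_j$ the probabilists' Hermite polynomials, and put $$h_{f,g}(\rho):=\sum_{\alpha\in\mathbb N_0^k}\Big(\int fH_\alpha\,d\gamma_k\Big)\Big(\int gH_\alpha\,d\gamma_k\Big)\rho^{|\alpha|},\qquad \rho\in[-1,1].$$ For a matrix $S$ with entries in $[-1,1]$, $h_{f,g}[S]$ is obtained by applying $h_{f,g}$ to each entry. $\|A\|_{\infty,1}$ is the norm of $A\in\mathbb R^{m\times n}$ as an operator $\ell_\infty^n\to\ell_1^m$. $\mathcal Q_{m,n}$ is the set of real quantum correlation matrices, i.e. of all $m\times n$ matrices $(\langle v_j,u_i\rangle_H)_{i,j}$ with unit vectors $u_1,\dots,u_m,v_1,\dots,v_n$ of a real Hilbert space $H$. $C(n;\mathbb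 R)$ is the set of real positive semidefinite $n\times n$ matrices with unit diagonal. $K_G^{\mathbb R}$ (the real Grothendieck constant) is the smallest $K>0$ such that $|\mathrm{tr}(A^\top S)|\le K\|A\|_{\infty,1}$ for all $m,n$, all $A\in\mathbb R^{m\times n}$ and all $S\in\mathcal Q_{m,n}$. For $r>0$, a function $\psi$ is completely real analytic on $(-r,r)$ at $0$ if it is real analytic on $(-r,r)$ and $\sum_{\nu}\frac{|\psi^{(\nu)}(0)|}{\nu!}r^\nu<\infty$; then $\psi_{\mathrm{abs}}(x):=\sum_{\nu}\frac{|\psi^{(\nu)}(0)|}{\nu!}x^\nu$ for $x\in[-r,r]$. (i) For all $A\in\mathbb R^{m\times n}$ and $S\in\mathcal Q_{m,n}$, $$|\mathrm{tr}(A^\top h_{f,g}[S])|\le r_\infty\|A\|_{\infty,1},$$ and for all $A\in\mathbb R^{n\times n}$ and $\Sigma\in C(n;\mathbb R)$, $$|\mathrm{tr}(A^\top h_{f,f}[\Sigma])|\le\|f\|_\infty^2\max_{x\in[-1,1]^n}|x^\top Ax|.$$ (ii) Suppose that $f$ or $g$ is odd (almost everywhere) and that $h_{f,g}:[-1,1]\to\mathbb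 R$ is injective. Put $r:=\max\{-h_{f,g}(1),h_{f,g}(1)\}$. Then $h_{f,g}$ is strictly increasing or strictly decreasing and is a homeomorphism of $[-1,1]$ onto $[-r,r]$; moreover $r=\max\{-\int fg\,d\gamma_k,\int fg\,d\gamma_k\}$ and $0<r\le r_\infty$. Suppose in addition that $h_{f,g}^{-1}|_{(-r,r)}$ is completely real analytic on $(-r,r)$ at $0$, and put $a:=(h_{f,g}^{-1}|_{(-r,r)})_{\mathrm{abs}}$. (ii-1) If $a(r)>1$, then there is exactly one number $c_k^*\in(0,r)$ with $a(c_k^*)=1$, and $K_G^{\mathbb R}\le r_\infty/c_k^*$. (ii-2) If $r=r_\infty$, then $a(r)>1$, so that there is exactly one number $c_k^*\in(0,r)$ with $a(c_k^*)=1$; there is exactly one $\gamma_k^*\in(0,r]$ with $K_G^{\mathbb R}=a(\gamma_k^*)$; and $$K_G^{\mathbb R}=a(\gamma_k^*)\le\min\Big\{\frac{r}{c_k^*},\,a(r)\Big\}.$$ -/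

import Mathlib

open MeasureTheory ProbabilityTheory Set
open scoped ENNReal RealInnerProductSpace

noncomputable section

namespace GrothendieckKrivine

/-! ## Matrices -/

/-- The norm of a real matrix, viewed as a bounded linear operator from `ℓ_∞^n` to `ℓ_1^m`
(the space `Fin n → ℝ` carries the maximum norm). -/
def normInftyOne {m n : ℕ} (A : Matrix (Fin m) (Fin n) ℝ) : ℝ :=
  ‖LinearMap.toContinuousLinearMap
    ((WithLp.linearEquiv 1 ℝ (Fin m → ℝ)).symm.toLinearMap ∘ₗ Matrix.toLin' A)‖

/-- The matrix of inner products of two finite families of vectors. -/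
def gramMatrix {H : Type*} [NormedAddCommGroup H] [InnerProductSpace ℝ H] {m n : ℕ}
    (u : Fin m → H) (v : Fin n → H) : Matrix (Fin m) (Fin n) ℝ :=
  Matrix.of fun i j => ⟪v j, u i⟫

/-- Real quantum correlation matrices: the matrices of inner products of two families of unit
vectors of some real Hilbert space. -/
def IsQuantumCorrelation {m n : ℕ} (S : Matrix (Fin m) (Fin n) ℝ) : Prop :=
  ∃ (H : Type) (_ : NormedAddCommGroup H) (_ : InnerProductSpace ℝ H) (_ : CompleteSpace H)
    (u : Fin m → H) (v : Fin n → H),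
    (∀ i, ‖u i‖ = 1) ∧ (∀ j, ‖v j‖ = 1) ∧ S = gramMatrix u v

/-- Real correlation matrices. -/
def IsCorrelation {n : ℕ} (S : Matrix (Fin n) (Fin n) ℝ) : Prop :=
  S.PosSemidef ∧ ∀ i, S i i = 1

/-- `K` is an admissible constant in the real Grothendieck inequality. -/
def IsGrothendieckBound (K : ℝ) : Prop :=
  ∀ (m n : ℕ) (A : Matrix (Fin m) (Fin n) ℝ) (H : Type) [NormedAddCommGroup H]
    [InnerProductSpace ℝ H] [CompleteSpace H] (u : Fin m → H) (v : Fin n → H),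
    (∀ i, ‖u i‖ = 1) → (∀ j, ‖v j‖ = 1) →
      |(A.transpose * gramMatrix u v).trace| ≤ K * normInftyOne A

/-- The real Grothendieck constant: the smallest admissible positive constant. It is taken in the
extended reals, so that an upper bound for it includes the existence of admissible constants (the
infimum of the empty set is `⊤`). -/
def grothendieckConstant : EReal :=
  sInf {x : EReal | ∃ K : ℝ, 0 < K ∧ IsGrothendieckBound K ∧ x = (K : EReal)}

/-! ## Gaussian Fourier-Hermite analysis -/

/-- The standard Gaussian measure on `ℝ^k`. -/
abbrev gaussianMeasure (k : ℕ) : Measure (EuclideanSpace ℝ (Fin k)) :=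
  stdGaussian (EuclideanSpace ℝ (Fin k))

/-- The orthonormal Hermite polynomial of multi-index `α`, that is, the product of the factors
`He_{α i} (x i) / √((α i)!)`, where `He` denotes the probabilists' Hermite polynomials. -/
def hermiteFun {k : ℕ} (α : Fin k → ℕ) (x : EuclideanSpace ℝ (Fin k)) : ℝ :=
  ∏ i, Polynomial.aeval (x i) (Polynomial.hermite (α i)) / √((α i).factorial : ℝ)

/-- The Fourier-Hermite coefficient of `f` of multi-index `α`. -/
def hermiteCoeff {k : ℕ} (f : EuclideanSpace ℝ (Fin k) → ℝ) (α : Fin k → ℕ) : ℝ :=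
  ∫ x, f x * hermiteFun α x ∂(gaussianMeasure k)

/-- The function `h_{f,g}`; it is considered on `[-1, 1]`, where the series converges absolutely
for square integrable `f` and `g`. -/
def hFun {k : ℕ} (f g : EuclideanSpace ℝ (Fin k) → ℝ) (ρ : ℝ) : ℝ :=
  ∑' α : Fin k → ℕ, hermiteCoeff f α * hermiteCoeff g α * ρ ^ (∑ i, α i)

/-- The inverse of the injective function `h_{f,g} : [-1, 1] → ℝ`. Only its values on
`h_{f,g}([-1, 1])` are meaningful. -/
def hInv {k : ℕ} (f g : EuclideanSpace ℝ (Fin k) → ℝ) : ℝ → ℝ :=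
  Function.invFunOn (hFun f g) (Icc (-1) 1)

/-- The number `r(f, g) = max {-h_{f,g}(1), h_{f,g}(1)}`. -/
def hRadius {k : ℕ} (f g : EuclideanSpace ℝ (Fin k) → ℝ) : ℝ :=
  max (-hFun f g 1) (hFun f g 1)

/-- The `L^∞` norm on `ℝ^k`. -/
def normInfty {k : ℕ} (f : EuclideanSpace ℝ (Fin k) → ℝ) : ℝ :=
  (eLpNorm f ∞ volume).toReal

/-- Oddness (almost everywhere). -/
def IsOddAE {k : ℕ} (f : EuclideanSpace ℝ (Fin k) → ℝ) : Prop :=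
  ∀ᵐ x ∂volume, f (-x) = -f x

/-! ## Completely real analytic functions -/

/-- The restriction of `ψ` to `(-r, r)` is completely real analytic on `(-r, r)` at `0`: it is real
analytic, and its Taylor coefficients at `0`, weighted by `r ^ n`, are absolutely summable. -/
def IsCompletelyRealAnalytic (r : ℝ) (ψ : ℝ → ℝ) : Prop :=
  AnalyticOnNhd ℝ ψ (Ioo (-r) r) ∧
    Summable fun n : ℕ => |iteratedDeriv n ψ 0 / (n.factorial : ℝ) * r ^ n|

/-- The function `ψ_abs`, given by the power series whose coefficients are the absolute values of
the Taylor coefficients of `ψ` at `0`. -/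
def absFun (ψ : ℝ → ℝ) (x : ℝ) : ℝ :=
  ∑' n : ℕ, |iteratedDeriv n ψ 0| / (n.factorial : ℝ) * x ^ n

end GrothendieckKrivine

end

open GrothendieckKrivine

noncomputable section

namespace GrothendieckKrivine

/-! ## Hermite polynomials and the Gaussian measure on the line -/

section OneDim

open Polynomial

local notation "γ₁" => gaussianReal 0 1

/-! The engine is a Mehler-type identity, `hFun_hasSum`. For unit vectors `u`, `v` of a Euclidean
space, `h_{f,g}(⟪u, v⟫)` equals `E[f(X_u) g(X_v)]`, where `X_u = ∑ a, u a • G a` is built from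
independent standard Gaussian vectors `G a` of `ℝ^k`. Both sides are bounded bilinear expressions in
`(f, g) ∈ L²(γ_k)`. They agree on the exponentials `x ↦ exp ⟪t, x⟫`, whose Hermite coefficients are
explicit, and the exponentials are total in `L²`. Orthonormality of the Hermite functions is enough.
No Mehler kernel is used, so `ρ = ±1` is included.

Part (i) follows. Families of unit vectors may be taken in a finite-dimensional Euclidean space, so
`tr(Aᵀ h[S])` is the expectation of `∑ A i j f(X_{u i}) g(X_{v j})`, which is bounded pointwise
almost everywhere by `r_∞ ‖A‖_{∞,1}`. For correlation matrices the pointwise bound uses the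
quadratic form instead. Iterating the argument with Hadamard products bounds the entrywise powers
`h[S]^l` by `r_∞^l`.

For part (ii), `h` is continuous and odd, hence a homeomorphism onto `[-r, r]` once it is injective.
Complete analyticity yields `ρ = ∑ b_l h(ρ)^l` on all of `[-1, 1]`, and this gives two bounds for
`K_G`. Krivine's bound: if `∑ |b_l| c^l = 1`, then `S' = h⁻¹[c S]` is again a quantum correlation
matrix (`IsQuantumCorrelation.map_tsum`). Part (i) applied to `S'` bounds `c S` by `r_∞`, so `K_G ≤
r_∞ / c`. Direct bound: expanding `S = ∑ b_l h[S]^l` and bounding term by term gives `K_G ≤ ∑ |b_l|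
r_∞^l`, which is `a(r)` when `r = r_∞`. Finally, a `2 × 2` example shows `√2 ≤ K_G`, hence `a(r) >
1` in the case `r = r_∞`. Existence and uniqueness of `c` and `γ` come from continuity and strict
monotonicity of `a` together with `a(0) = 0`. -/

lemma mem_interior_integrableExpSet_gaussianReal (t : ℝ) :
    t ∈ interior (integrableExpSet (fun x : ℝ => x) γ₁) := by
  simp [integrableExpSet_fun_id_gaussianReal]

lemma integrable_eval_mul_exp (p : ℝ[X]) (t : ℝ) :
    Integrable (fun x => p.eval x * Real.exp (t * x)) γ₁ := by
  induction p using Polynomial.induction_on' with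
  | add p q hp hq =>
    simp only [eval_add, add_mul]
    exact hp.add hq
  | monomial n a =>
    simpa [mul_assoc] using (integrable_pow_mul_exp_of_mem_interior_integrableExpSet
      (mem_interior_integrableExpSet_gaussianReal t) n).const_mul a

lemma hasDerivAt_integral_pow_mul_exp_gaussianReal (n : ℕ) (t : ℝ) :
    HasDerivAt (fun t => ∫ x, x ^ n * Real.exp (t * x) ∂γ₁)
      (∫ x, x ^ (n + 1) * Real.exp (t * x) ∂γ₁) t :=
  hasDerivAt_integral_pow_mul_exp_real (mem_interior_integrableExpSet_gaussianReal t) n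

lemma integral_exp_mul_gaussianReal (t : ℝ) :
    ∫ x, Real.exp (t * x) ∂γ₁ = Real.exp (t ^ 2 / 2) := by
  simpa [mgf] using congrFun (mgf_fun_id_gaussianReal (μ := 0) (v := 1)) t

/-- Integration by parts for monomials, obtained by differentiating in `t` instead: each derivative
of the exponential moment brings down a factor `x`, and the base case is the derivative of `exp (t ^
2 / 2)`. -/
lemma integral_pow_succ_mul_exp (n : ℕ) (t : ℝ) :
    ∫ x, x ^ (n + 1) * Real.exp (t * x) ∂γ₁ =
      n * ∫ x, x ^ (n - 1) * Real.exp (t * x) ∂γ₁ + t * ∫ x, x ^ n * Real.exp (t * x) ∂γ₁ := by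
  induction n generalizing t with
  | zero =>
    have h := hasDerivAt_integral_pow_mul_exp_gaussianReal 0 t
    have h2 : HasDerivAt (fun t : ℝ => Real.exp (t ^ 2 / 2)) (Real.exp (t ^ 2 / 2) * t) t := by
      have := ((hasDerivAt_pow 2 t).div_const 2).exp
      convert this using 1
      simp
    simp only [pow_zero, one_mul, integral_exp_mul_gaussianReal] at h ⊢
    rw [h.unique h2]
    simp [mul_comm]
  | succ n ih =>
    have h := hasDerivAt_integral_pow_mul_exp_gaussianReal (n + 1) t
    -- The recursion for `n` holds for every `t`, so differentiating both of its sides yields the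
    -- recursion for `n + 1`.
    rw [funext ih] at h
    have h2 := ((hasDerivAt_integral_pow_mul_exp_gaussianReal (n - 1) t).const_mul (n : ℝ)).add
      ((hasDerivAt_id t).mul (hasDerivAt_integral_pow_mul_exp_gaussianReal n t))
    have h3 := h.unique h2
    rw [h3]
    -- The exponent `n - 1` is truncated at `n = 0`; there the coefficient `n` kills the term.
    rcases n with _ | n
    · simp
    · simp; ring

/-- Gaussian integration by parts. -/
lemma integral_X_mul_sub_derivative (p : ℝ[X]) (t : ℝ) :
    ∫ x, (X * p - derivative p).eval x * Real.exp (t * x) ∂γ₁ =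
      t * ∫ x, p.eval x * Real.exp (t * x) ∂γ₁ := by
  induction p using Polynomial.induction_on' with
  | add p q hp hq =>
    have h1 : X * (p + q) - derivative (p + q) =
      (X * p - derivative p) + (X * q - derivative q) := by simp; ring
    rw [h1]
    simp only [eval_add, add_mul]
    rw [integral_add (integrable_eval_mul_exp _ t) (integrable_eval_mul_exp _ t),
      integral_add (integrable_eval_mul_exp _ t) (integrable_eval_mul_exp _ t), hp, hq, mul_add]
  | monomial n a =>
    have h1 : ∀ x : ℝ, (X * monomial n a - derivative (monomial n a)).eval x * Real.exp (t * x) =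
        a * (x ^ (n + 1) * Real.exp (t * x)) - a * n * (x ^ (n - 1) * Real.exp (t * x)) := by
      intro x; simp [derivative_monomial]; ring
    have hi : ∀ n : ℕ, Integrable (fun x => x ^ n * Real.exp (t * x)) γ₁ := fun n => by
      simpa using integrable_eval_mul_exp (X ^ n) t
    simp only [h1]
    rw [integral_sub ((hi _).const_mul _) ((hi _).const_mul _), integral_const_mul,
      integral_const_mul, integral_pow_succ_mul_exp]
    simp only [eval_monomial, mul_assoc a, integral_const_mul]
    ring

/-- The Hermite polynomials with real coefficients. -/
def realHermite (n : ℕ) : ℝ[X] := (hermite n).map (Int.castRingHom ℝ)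

lemma realHermite_succ (n : ℕ) :
    realHermite (n + 1) = X * realHermite n - derivative (realHermite n) := by
  simp [realHermite, hermite_succ, derivative_map]

lemma aeval_hermite (n : ℕ) (x : ℝ) : aeval x (hermite n) = (realHermite n).eval x := by
  rw [realHermite, eval_map, aeval_def]; rfl

/-- The operator `p ↦ X p - p'` raises the Hermite degree by one, and under the exponential integral
it acts as multiplication by `t`. -/
lemma integral_realHermite_mul_exp (n : ℕ) (t : ℝ) :
    ∫ x, (realHermite n).eval x * Real.exp (t * x) ∂γ₁ = t ^ n * Real.exp (t ^ 2 / 2) := by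
  induction n with
  | zero => simp [realHermite, integral_exp_mul_gaussianReal]
  | succ n ih => rw [realHermite_succ, integral_X_mul_sub_derivative, ih]; ring

lemma integrable_eval_gaussianReal (p : ℝ[X]) : Integrable (fun x => p.eval x) γ₁ := by
  simpa using integrable_eval_mul_exp p 0

/-- Integration by parts at `t = 0` moves one derivative onto `q` for each Hermite degree.
Orthogonality then reduces to counting degrees. -/
lemma integral_realHermite_mul (n : ℕ) (q : ℝ[X]) :
    ∫ x, (realHermite n * q).eval x ∂γ₁ = ∫ x, (derivative^[n] q).eval x ∂γ₁ := by
  induction n generalizing q with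
  | zero => simp [realHermite]
  | succ n ih =>
    rw [Function.iterate_succ_apply, ← ih (derivative q)]
    have h := integral_X_mul_sub_derivative (realHermite n * q) 0
    have h1 : X * (realHermite n * q) - derivative (realHermite n * q) =
        realHermite (n + 1) * q - realHermite n * derivative q := by
      rw [realHermite_succ, derivative_mul]; ring
    rw [h1] at h
    simp only [eval_sub, zero_mul, Real.exp_zero, mul_one] at h
    rw [integral_sub (integrable_eval_gaussianReal _) (integrable_eval_gaussianReal _)] at h
    linarith

lemma natDegree_realHermite (n : ℕ) : (realHermite n).natDegree = n := by
  rw [realHermite, (hermite_monic n).natDegree_map, natDegree_hermite]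

lemma integral_realHermite_mul_realHermite (n m : ℕ) :
    ∫ x, (realHermite n * realHermite m).eval x ∂γ₁ = if n = m then (n.factorial : ℝ) else 0 := by
  have key : ∀ n m : ℕ, m < n → ∫ x, (realHermite n * realHermite m).eval x ∂γ₁ = 0 := by
    intro n m h
    rw [integral_realHermite_mul,
      iterate_derivative_eq_zero (by rwa [natDegree_realHermite])]
    simp
  split_ifs with h
  · subst h
    rw [integral_realHermite_mul]
    have h1 : derivative^[n] (realHermite n) = C (n.factorial : ℝ) := by
      have hd : (derivative^[n] (realHermite n)).natDegree = 0 := by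
        have := natDegree_iterate_derivative (realHermite n) n
        rw [natDegree_realHermite] at this
        omega
      rw [eq_C_of_natDegree_eq_zero hd, coeff_iterate_derivative]
      have hc : (realHermite n).coeff n = 1 := by simp [realHermite]
      simp [hc, Nat.descFactorial_self]
    simp [h1]
  · rcases lt_or_gt_of_ne h with h | h
    · rw [mul_comm, key m n h]
    · exact key n m h

end OneDim

/-! ## Hermite functions in several variables -/

section MultiDim

variable {k : ℕ}

lemma map_toLp_pi_gaussianReal :
    (Measure.pi fun _ : Fin k => gaussianReal 0 1).map (MeasurableEquiv.toLp 2 (Fin k → ℝ)) =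
      gaussianMeasure k :=
  map_pi_eq_stdGaussian

lemma integral_prod_gaussianMeasure (F : Fin k → ℝ → ℝ) :
    ∫ x, ∏ i, F i (x i) ∂(gaussianMeasure k) = ∏ i, ∫ y, F i y ∂(gaussianReal 0 1) := by
  rw [← map_toLp_pi_gaussianReal, integral_map_equiv]
  exact integral_fintype_prod_eq_prod (μ := fun _ : Fin k => gaussianReal 0 1) F

lemma integrable_prod_gaussianMeasure {F : Fin k → ℝ → ℝ}
    (hF : ∀ i, Integrable (F i) (gaussianReal 0 1)) :
    Integrable (fun x => ∏ i, F i (x i)) (gaussianMeasure k) := by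
  rw [← map_toLp_pi_gaussianReal, integrable_map_equiv]
  exact Integrable.fintype_prod (μ := fun _ : Fin k => gaussianReal 0 1) hF

lemma hermiteFun_eq (α : Fin k → ℕ) (x : EuclideanSpace ℝ (Fin k)) :
    hermiteFun α x = ∏ i, (realHermite (α i)).eval (x i) / √((α i).factorial : ℝ) := by
  simp only [hermiteFun, aeval_hermite]

lemma continuous_hermiteFun (α : Fin k → ℕ) : Continuous (hermiteFun α) := by
  simp only [funext (hermiteFun_eq α)]
  fun_prop

lemma hermiteFun_mul (α β : Fin k → ℕ) (x : EuclideanSpace ℝ (Fin k)) :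
    hermiteFun α x * hermiteFun β x = ∏ i, (realHermite (α i) * realHermite (β i)).eval (x i) *
      (√((α i).factorial : ℝ) * √((β i).factorial : ℝ))⁻¹ := by
  rw [hermiteFun_eq, hermiteFun_eq, ← Finset.prod_mul_distrib]
  refine Finset.prod_congr rfl fun i _ => ?_
  rw [Polynomial.eval_mul, div_mul_div_comm, div_eq_mul_inv]

lemma memLp_hermiteFun (α : Fin k → ℕ) : MemLp (hermiteFun α) 2 (gaussianMeasure k) := by
  rw [memLp_two_iff_integrable_sq (continuous_hermiteFun α).aestronglyMeasurable]
  simp only [sq, hermiteFun_mul]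
  exact integrable_prod_gaussianMeasure (F := fun i y =>
    (realHermite (α i) * realHermite (α i)).eval y *
      (√((α i).factorial : ℝ) * √((α i).factorial : ℝ))⁻¹)
    fun i => (integrable_eval_gaussianReal _).mul_const _

lemma integral_hermiteFun_mul (α β : Fin k → ℕ) :
    ∫ x, hermiteFun α x * hermiteFun β x ∂(gaussianMeasure k) = if α = β then 1 else 0 := by
  simp only [hermiteFun_mul]
  rw [integral_prod_gaussianMeasure (fun i y =>
    (realHermite (α i) * realHermite (β i)).eval y *
      (√((α i).factorial : ℝ) * √((β i).factorial : ℝ))⁻¹)]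
  simp only [integral_mul_const, integral_realHermite_mul_realHermite]
  split_ifs with h
  · subst h
    refine Finset.prod_eq_one fun i _ => ?_
    have : (0 : ℝ) < (α i).factorial := by positivity
    rw [if_pos rfl, Real.mul_self_sqrt this.le, mul_inv_cancel₀ this.ne']
  · obtain ⟨i, hi⟩ := Function.ne_iff.1 h
    exact Finset.prod_eq_zero (Finset.mem_univ i) (by simp [hi])

/-- The Hermite functions as elements of `L²`. -/
def hermiteLp (α : Fin k → ℕ) : Lp ℝ 2 (gaussianMeasure k) :=
  (memLp_hermiteFun α).toLp

lemma inner_toLp {Ω : Type*} [MeasurableSpace Ω] {μ : Measure Ω} {f g : Ω → ℝ}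
    (hf : MemLp f 2 μ) (hg : MemLp g 2 μ) : ⟪hf.toLp, hg.toLp⟫ = ∫ x, f x * g x ∂μ := by
  rw [L2.inner_def]
  refine integral_congr_ae ?_
  filter_upwards [hf.coeFn_toLp, hg.coeFn_toLp] with x hx hy
  simp [hx, hy, mul_comm]

lemma orthonormal_hermiteLp : Orthonormal ℝ (hermiteLp (k := k)) := by
  classical
  rw [orthonormal_iff_ite]
  intro α β
  rw [hermiteLp, hermiteLp, inner_toLp, integral_hermiteFun_mul]

lemma hermiteCoeff_eq_inner {f : EuclideanSpace ℝ (Fin k) → ℝ}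
    (hf : MemLp f 2 (gaussianMeasure k)) (α : Fin k → ℕ) :
    hermiteCoeff f α = ⟪hermiteLp α, hf.toLp⟫ := by
  rw [hermiteLp, inner_toLp, hermiteCoeff]
  simp only [mul_comm]

/-! ## Exponential functions -/

lemma integrable_exp_inner {E : Type*} [NormedAddCommGroup E] [InnerProductSpace ℝ E]
    [FiniteDimensional ℝ E] [MeasurableSpace E] [BorelSpace E] (t : E) :
    Integrable (fun x => Real.exp ⟪t, x⟫) (stdGaussian E) := by
  have h := IsGaussian.map_eq_gaussianReal (μ := stdGaussian E) (innerSL ℝ t)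
  have h2 : Integrable (fun y : ℝ => Real.exp y) ((stdGaussian E).map (innerSL ℝ t)) := by
    rw [h]
    simpa using integrable_exp_mul_gaussianReal 1
  exact h2.comp_measurable (innerSL ℝ t).continuous.measurable

lemma integral_exp_inner {E : Type*} [NormedAddCommGroup E] [InnerProductSpace ℝ E]
    [FiniteDimensional ℝ E] [MeasurableSpace E] [BorelSpace E] (t : E) :
    ∫ x, Real.exp ⟪t, x⟫ ∂(stdGaussian E) = Real.exp (‖t‖ ^ 2 / 2) := by
  have h := mgf_gaussianReal (IsGaussian.map_eq_gaussianReal (μ := stdGaussian E) (innerSL ℝ t)) 1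
  rw [integral_strongDual_stdGaussian, variance_dual_stdGaussian, innerSL_apply_norm] at h
  simpa [mgf] using h

lemma memLp_exp_inner {E : Type*} [NormedAddCommGroup E] [InnerProductSpace ℝ E]
    [FiniteDimensional ℝ E] [MeasurableSpace E] [BorelSpace E] (t : E) :
    MemLp (fun x => Real.exp ⟪t, x⟫) 2 (stdGaussian E) := by
  rw [memLp_two_iff_integrable_sq (by fun_prop)]
  refine (integrable_exp_inner ((2 : ℝ) • t)).congr (.of_forall fun x => ?_)
  simp only [inner_smul_left, ← Real.exp_nat_mul]
  simp

lemma hermiteCoeff_exp_inner (t : EuclideanSpace ℝ (Fin k)) (α : Fin k → ℕ) :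
    hermiteCoeff (fun x => Real.exp ⟪t, x⟫) α =
      ∏ i, t i ^ α i * Real.exp (t i ^ 2 / 2) * (√((α i).factorial : ℝ))⁻¹ := by
  have h : ∀ x : EuclideanSpace ℝ (Fin k), Real.exp ⟪t, x⟫ * hermiteFun α x =
      ∏ i, (realHermite (α i)).eval (x i) * Real.exp (t i * x i) *
        (√((α i).factorial : ℝ))⁻¹ := by
    intro x
    rw [hermiteFun_eq, PiLp.inner_apply, Real.exp_sum, ← Finset.prod_mul_distrib]
    refine Finset.prod_congr rfl fun i _ => ?_
    simp only [RCLike.inner_apply, conj_trivial, mul_comm (x i)]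
    ring
  simp only [hermiteCoeff, h]
  rw [integral_prod_gaussianMeasure (fun i y => (realHermite (α i)).eval y *
    Real.exp (t i * y) * (√((α i).factorial : ℝ))⁻¹)]
  simp only [integral_mul_const, integral_realHermite_mul_exp]

lemma hasSum_mul_of_summable_norm {ι κ : Type*} {f : ι → ℝ} {g : κ → ℝ} {s t : ℝ}
    (hf : HasSum f s) (hg : HasSum g t) (hf' : Summable fun i => ‖f i‖)
    (hg' : Summable fun j => ‖g j‖) : HasSum (fun p : ι × κ => f p.1 * g p.2) (s * t) :=
  hf.mul hg (summable_mul_of_summable_norm hf' hg')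

/-- Splitting off the first coordinate turns the sum over multi-indices into a product of two
series. Absolute summability is carried through the induction because that product needs it. -/
lemma hasSum_prod_pi {a : ℕ → ℝ → ℝ} {s : ℝ → ℝ} (ha : ∀ y, HasSum (fun n => a n y) (s y))
    (ha' : ∀ y, Summable fun n => ‖a n y‖) (y : Fin k → ℝ) :
    HasSum (fun α : Fin k → ℕ => ∏ i, a (α i) (y i)) (∏ i, s (y i)) ∧
      Summable fun α : Fin k → ℕ => ‖∏ i, a (α i) (y i)‖ := by
  induction k with
  | zero =>
    refine ⟨?_, ?_⟩
    · simp
    · exact (hasSum_fintype _).summable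
  | succ k ih =>
    obtain ⟨h1, h2⟩ := ih (fun i => y i.succ)
    let e : ℕ × (Fin k → ℕ) ≃ (Fin (k + 1) → ℕ) := Fin.consEquiv fun _ => ℕ
    have he : ∀ p, ∏ i, a (e p i) (y i) = a p.1 (y 0) * ∏ i, a (p.2 i) (y i.succ) := fun p => by
      rw [Fin.prod_univ_succ]; rfl
    clear_value e
    constructor
    · rw [← e.hasSum_iff, Fin.prod_univ_succ]
      simp only [Function.comp_def, he]
      have h3 := hasSum_mul_of_summable_norm (ha (y 0)) h1 (ha' _) h2
      exact h3
    · rw [← e.summable_iff]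
      simp only [Function.comp_def, he]
      have h3 := (ha' (y 0)).mul_norm h2
      exact h3

end MultiDim

/-! ## Bilinear series along an orthonormal family -/

section Hilbert

variable {E E' ι τ : Type*} [NormedAddCommGroup E] [InnerProductSpace ℝ E]
  [NormedAddCommGroup E'] [InnerProductSpace ℝ E']

lemma Orthonormal.summable_abs_inner_mul_inner {v : ι → E} (hv : Orthonormal ℝ v) (F G : E) :
    Summable fun i => |⟪v i, F⟫ * ⟪v i, G⟫| := by
  refine Summable.of_nonneg_of_le (fun _ => abs_nonneg _) (fun i => ?_)
    ((hv.inner_products_summable F).add (hv.inner_products_summable G))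
  rw [abs_mul, Real.norm_eq_abs, Real.norm_eq_abs]
  nlinarith [sq_nonneg (|⟪v i, F⟫| - |⟪v i, G⟫|), sq_nonneg |⟪v i, F⟫|, sq_nonneg |⟪v i, G⟫|]

/-- By Bessel's inequality the coefficients `c i * ⟪v i, G⟫` are square summable, so `w = ∑ c i ⟪v
i, G⟫ v i` exists and represents the series as a functional of `F`. -/
lemma Orthonormal.exists_hasSum_inner [CompleteSpace E] {v : ι → E} (hv : Orthonormal ℝ v) {c : ι → ℝ}
    (hc : ∀ i, |c i| ≤ 1) (G : E) :
    ∃ w : E, ∀ F, HasSum (fun i => c i * (⟪v i, F⟫ * ⟪v i, G⟫)) ⟪w, F⟫ := by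
  have hmem : Memℓp (fun i => c i * ⟪v i, G⟫) 2 := by
    refine memℓp_gen ?_
    refine Summable.of_nonneg_of_le (fun _ => by positivity) (fun i => ?_)
      (hv.inner_products_summable G)
    simp only [ENNReal.toReal_ofNat, Real.rpow_ofNat, norm_mul, Real.norm_eq_abs]
    gcongr
    exact mul_le_of_le_one_left (abs_nonneg _) (hc i)
  refine ⟨hv.orthogonalFamily.linearIsometry ⟨_, hmem⟩, fun F => ?_⟩
  have h := (hv.orthogonalFamily.hasSum_linearIsometry ⟨_, hmem⟩).mapL (innerSL ℝ F)
  rw [real_inner_comm]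
  have hterm : ∀ i, innerSL ℝ F ((LinearIsometry.toSpanSingleton ℝ E (hv.1 i))
      (c i * ⟪v i, G⟫)) = c i * (⟪v i, F⟫ * ⟪v i, G⟫) := fun i => by
    simp [real_inner_comm (v i) F]
    ring
  simp only [hterm] at h
  exact h

/-- With one argument fixed, both sides are bounded functionals of the other, so their representing
vectors coincide once they agree on a total family. This is applied to each argument in turn.
Completeness of `v` is not needed. -/
lemma Orthonormal.hasSum_inner_of_total [CompleteSpace E] [CompleteSpace E'] {v : ι → E} (hv : Orthonormal ℝ v) {c : ι → ℝ}
    (hc : ∀ i, |c i| ≤ 1) {e : τ → E} (he : ∀ x : E, (∀ t, ⟪e t, x⟫ = 0) → x = 0)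
    (J J' : E →L[ℝ] E')
    (h : ∀ t s, HasSum (fun i => c i * (⟪v i, e t⟫ * ⟪v i, e s⟫)) ⟪J (e t), J' (e s)⟫) (F G : E) :
    HasSum (fun i => c i * (⟪v i, F⟫ * ⟪v i, G⟫)) ⟪J F, J' G⟫ := by
  have key : ∀ s F, HasSum (fun i => c i * (⟪v i, F⟫ * ⟪v i, e s⟫)) ⟪J F, J' (e s)⟫ := by
    intro s F
    obtain ⟨w, hw⟩ := Orthonormal.exists_hasSum_inner hv hc (e s)
    have : w - ContinuousLinearMap.adjoint J (J' (e s)) = 0 := by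
      refine he _ fun t => ?_
      rw [inner_sub_right, ContinuousLinearMap.adjoint_inner_right, real_inner_comm,
        (hw (e t)).unique (h t s), sub_self]
    rw [← ContinuousLinearMap.adjoint_inner_right, ← sub_eq_zero.1 this, real_inner_comm]
    exact hw F
  obtain ⟨w, hw⟩ := Orthonormal.exists_hasSum_inner hv hc F
  have hcomm : ∀ i (G : E), ⟪v i, F⟫ * ⟪v i, G⟫ = ⟪v i, G⟫ * ⟪v i, F⟫ := fun i G => mul_comm _ _
  simp only [hcomm]
  have : w - ContinuousLinearMap.adjoint J' (J F) = 0 := by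
    refine he _ fun t => ?_
    have hk := key t F
    simp only [hcomm] at hk
    rw [inner_sub_right, ContinuousLinearMap.adjoint_inner_right, real_inner_comm,
      (hw (e t)).unique hk, real_inner_comm, sub_self]
  rw [← ContinuousLinearMap.adjoint_inner_left, ← sub_eq_zero.1 this]
  exact hw G

end Hilbert

/-! ## Totality of the exponential functions -/

section Total

variable {E : Type*} [NormedAddCommGroup E] [InnerProductSpace ℝ E] [FiniteDimensional ℝ E]
  [MeasurableSpace E] [BorelSpace E]

/-- In each direction the moment generating function is finite everywhere and extends analytically
to the complex plane. Its value at `Complex.I` is the characteristic function, which determines the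
measure. -/
lemma measure_ext_of_integral_exp_inner {μ ν : Measure E} [IsFiniteMeasure μ] [IsFiniteMeasure ν]
    (hμ : ∀ t : E, Integrable (fun x => Real.exp ⟪t, x⟫) μ)
    (h : ∀ t : E, ∫ x, Real.exp ⟪t, x⟫ ∂μ = ∫ x, Real.exp ⟪t, x⟫ ∂ν) : μ = ν := by
  refine Measure.ext_of_charFun (funext fun t => ?_)
  have hexp : ∀ (s : ℝ) (x : E), Real.exp (s * ⟪t, x⟫) = Real.exp ⟪s • t, x⟫ := fun s x => by
    rw [real_inner_smul_left]
  have hmgf : mgf (fun x => ⟪t, x⟫) μ = mgf (fun x => ⟪t, x⟫) ν := by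
    ext s
    simp only [mgf, hexp, h]
  have hset : integrableExpSet (fun x => ⟪t, x⟫) μ = univ := by
    refine eq_univ_of_forall fun s => ?_
    simp only [integrableExpSet, mem_ofPred_eq, hexp, hμ]
  have h0 : μ.real univ = ν.real univ := by simpa using h 0
  have hz : μ = 0 ↔ ν = 0 := by
    rw [← Measure.measure_univ_eq_zero, ← Measure.measure_univ_eq_zero,
      ← measureReal_eq_zero_iff, ← measureReal_eq_zero_iff, h0]
  have := eqOn_complexMGF_of_mgf' hmgf hz (x := Complex.I) (by simp [hset])
  simp only [complexMGF] at this
  simpa only [charFun_apply, mul_comm Complex.I, real_inner_comm] using this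

/-- The finite measures with densities `f⁺` and `f⁻` have the same exponential integrals, so they
are equal. Hence `f⁺ = f⁻` almost everywhere, which forces `f = 0`. -/
lemma ae_eq_zero_of_integral_exp_inner {μ : Measure E} [IsFiniteMeasure μ] {f : E → ℝ}
    (hfm : Measurable f) (hf : ∀ t : E, Integrable (fun x => f x * Real.exp ⟪t, x⟫) μ)
    (h : ∀ t : E, ∫ x, f x * Real.exp ⟪t, x⟫ ∂μ = 0) : f =ᵐ[μ] 0 := by
  have hfi : Integrable f μ := by simpa using hf 0
  have hm : ∀ g : E → ℝ, Measurable g → Measurable fun x => ENNReal.ofReal (g x) :=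
    fun g hg => hg.ennreal_ofReal
  have hint : ∀ g : E → ℝ, Measurable g → ∀ t : E,
      ∫ x, Real.exp ⟪t, x⟫ ∂(μ.withDensity fun x => ENNReal.ofReal (g x)) =
        ∫ x, max (g x) 0 * Real.exp ⟪t, x⟫ ∂μ := by
    intro g hg t
    rw [integral_withDensity_eq_integral_toReal_smul (hm g hg) (by simp)]
    simp only [ENNReal.toReal_ofReal', smul_eq_mul]
  have hmax : ∀ g : E → ℝ, Measurable g →
      (∀ t : E, Integrable (fun x => g x * Real.exp ⟪t, x⟫) μ) → ∀ t : E,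
        Integrable (fun x => max (g x) 0 * Real.exp ⟪t, x⟫) μ := by
    intro g hg hgi t
    refine (hgi t).mono (by fun_prop) (.of_forall fun x => ?_)
    rw [norm_mul, norm_mul]
    gcongr
    rw [Real.norm_eq_abs, Real.norm_eq_abs, abs_of_nonneg (le_max_right _ _)]
    exact max_le (le_abs_self _) (abs_nonneg _)
  have hf' : ∀ t : E, Integrable (fun x => -f x * Real.exp ⟪t, x⟫) μ := fun t => by
    simpa using (hf t).neg
  have hneg := hmax (fun x => -f x) hfm.neg hf'
  have : IsFiniteMeasure (μ.withDensity fun x => ENNReal.ofReal (f x)) :=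
    isFiniteMeasure_withDensity_ofReal hfi.2
  have : IsFiniteMeasure (μ.withDensity fun x => ENNReal.ofReal (-f x)) :=
    isFiniteMeasure_withDensity_ofReal hfi.neg.2
  have heq : (μ.withDensity fun x => ENNReal.ofReal (f x)) =
      μ.withDensity fun x => ENNReal.ofReal (-f x) := by
    refine measure_ext_of_integral_exp_inner (fun t => ?_) fun t => ?_
    · rw [integrable_withDensity_iff_integrable_smul' (hm f hfm) (by simp)]
      simpa only [ENNReal.toReal_ofReal', smul_eq_mul] using hmax f hfm hf t
    · rw [hint f hfm, hint (fun x => -f x) hfm.neg, ← sub_eq_zero,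
        ← integral_sub (hmax f hfm hf t) (hneg t)]
      refine Eq.trans ?_ (h t)
      refine integral_congr_ae (.of_forall fun x => ?_)
      simp only [← sub_mul]
      rcases le_total (f x) 0 with hx | hx
      · rw [max_eq_right hx, max_eq_left (by linarith)]; ring
      · rw [max_eq_left hx, max_eq_right (by linarith)]; ring
  rw [withDensity_eq_iff (hm f hfm).aemeasurable (hm (fun x => -f x) hfm.neg).aemeasurable
    (by simpa using hfi.lintegral_lt_top.ne)] at heq
  filter_upwards [heq] with x hx
  rcases le_total (f x) 0 with h0 | h0
  · rw [ENNReal.ofReal_of_nonpos h0, eq_comm, ENNReal.ofReal_eq_zero] at hx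
    simp; linarith
  · rw [ENNReal.ofReal_of_nonpos (by linarith : -f x ≤ 0), ENNReal.ofReal_eq_zero] at hx
    simp; linarith

lemma eq_zero_of_inner_exp (x : Lp ℝ 2 (stdGaussian E))
    (h : ∀ t : E, ⟪(memLp_exp_inner t).toLp, x⟫ = 0) : x = 0 := by
  have hm := (Lp.stronglyMeasurable x).measurable
  refine (Lp.eq_zero_iff_ae_eq_zero).2 (ae_eq_zero_of_integral_exp_inner hm (fun t => ?_) ?_)
  · exact (Lp.memLp x).integrable_mul (memLp_exp_inner t)
  · intro t
    rw [← h t, ← Lp.toLp_coeFn x (Lp.memLp x), inner_toLp]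
    refine integral_congr_ae ?_
    filter_upwards [(Lp.memLp x).coeFn_toLp] with y hy
    rw [hy, mul_comm]

end Total

/-! ## Gaussian random vectors indexed by vectors -/

section Field

variable {ι : Type*} [Fintype ι] {k : ℕ}

/-- The elementary tensor `u ⊗ t`. -/
def tensor (u : EuclideanSpace ℝ ι) (t : EuclideanSpace ℝ (Fin k)) :
    EuclideanSpace ℝ (ι × Fin k) :=
  WithLp.toLp 2 fun p => u p.1 * t p.2

/-- The random vector `∑ a, u a • G a`, where the `G a` are the independent standard Gaussian
vectors given by the rows of `ω`. -/
def gaussianVec (u : EuclideanSpace ℝ ι) (ω : EuclideanSpace ℝ (ι × Fin k)) :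
    EuclideanSpace ℝ (Fin k) :=
  WithLp.toLp 2 fun j => ∑ a, u a * ω (a, j)

lemma inner_tensor (u v : EuclideanSpace ℝ ι) (t s : EuclideanSpace ℝ (Fin k)) :
    ⟪tensor u t, tensor v s⟫ = ⟪u, v⟫ * ⟪t, s⟫ := by
  simp only [tensor, PiLp.inner_apply, RCLike.inner_apply, conj_trivial, Fintype.sum_prod_type,
    Finset.sum_mul_sum]
  refine Finset.sum_congr rfl fun a _ => Finset.sum_congr rfl fun j _ => ?_
  ring

/-- Linear functionals of the field are linear functionals of the single Gaussian vector `ω`;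
covariances are therefore read off from inner products of elementary tensors. -/
lemma inner_gaussianVec (u : EuclideanSpace ℝ ι) (t : EuclideanSpace ℝ (Fin k))
    (ω : EuclideanSpace ℝ (ι × Fin k)) : ⟪t, gaussianVec u ω⟫ = ⟪tensor u t, ω⟫ := by
  simp only [tensor, gaussianVec, PiLp.inner_apply, RCLike.inner_apply, conj_trivial,
    Fintype.sum_prod_type, Finset.sum_mul]
  rw [Finset.sum_comm]
  refine Finset.sum_congr rfl fun a _ => Finset.sum_congr rfl fun j _ => ?_
  ring

lemma gaussianVec_neg (u : EuclideanSpace ℝ ι) (ω : EuclideanSpace ℝ (ι × Fin k)) :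
    gaussianVec (-u) ω = -gaussianVec u ω := by
  ext j
  simp [gaussianVec]

lemma continuous_gaussianVec (u : EuclideanSpace ℝ ι) :
    Continuous (gaussianVec (k := k) u) := by
  unfold gaussianVec
  fun_prop

lemma measurePreserving_gaussianVec {u : EuclideanSpace ℝ ι} (hu : ‖u‖ = 1) :
    MeasurePreserving (gaussianVec u) (stdGaussian (EuclideanSpace ℝ (ι × Fin k)))
      (gaussianMeasure k) := by
  have hm := (continuous_gaussianVec (k := k) u).measurable
  refine ⟨hm, ?_⟩
  have := Measure.isProbabilityMeasure_map (μ := stdGaussian (EuclideanSpace ℝ (ι × Fin k)))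
    hm.aemeasurable
  refine Measure.ext_of_charFun (funext fun t => ?_)
  rw [charFun_apply, integral_map hm.aemeasurable (by fun_prop)]
  simp only [real_inner_comm t, inner_gaussianVec]
  have h := charFun_stdGaussian (tensor u t)
  rw [charFun_apply] at h
  simp only [real_inner_comm (tensor u t)] at h
  rw [h, charFun_stdGaussian]
  congr 3
  norm_cast
  rw [← real_inner_self_eq_norm_sq, inner_tensor, real_inner_self_eq_norm_sq,
    real_inner_self_eq_norm_sq, hu]
  simp

lemma integral_exp_gaussianVec {u v : EuclideanSpace ℝ ι} (hu : ‖u‖ = 1) (hv : ‖v‖ = 1)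
    (t s : EuclideanSpace ℝ (Fin k)) :
    ∫ ω, Real.exp ⟪t, gaussianVec u ω⟫ * Real.exp ⟪s, gaussianVec v ω⟫
      ∂(stdGaussian (EuclideanSpace ℝ (ι × Fin k))) =
        Real.exp (‖t‖ ^ 2 / 2 + ‖s‖ ^ 2 / 2 + ⟪u, v⟫ * ⟪t, s⟫) := by
  simp only [← Real.exp_add, inner_gaussianVec, ← inner_add_left]
  rw [integral_exp_inner]
  congr 1
  rw [← real_inner_self_eq_norm_sq, ← real_inner_self_eq_norm_sq, ← real_inner_self_eq_norm_sq,
    inner_add_left, inner_add_right, inner_add_right, inner_tensor, inner_tensor, inner_tensor,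
    inner_tensor, real_inner_self_eq_norm_sq u, real_inner_self_eq_norm_sq v, hu, hv,
    real_inner_comm u v, real_inner_comm t s]
  ring

/-- The product over coordinates of the Taylor series of `exp (ρ * (t i * s i))`; the factorials
split into the two normalising square roots. -/
lemma hasSum_hermiteCoeff_exp (t s : EuclideanSpace ℝ (Fin k)) (ρ : ℝ) :
    HasSum (fun α => ρ ^ (∑ i, α i) * (hermiteCoeff (fun x => Real.exp ⟪t, x⟫) α *
      hermiteCoeff (fun x => Real.exp ⟪s, x⟫) α))
        (Real.exp (‖t‖ ^ 2 / 2 + ‖s‖ ^ 2 / 2 + ρ * ⟪t, s⟫)) := by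
  have h1 : ∀ y : ℝ, HasSum (fun n : ℕ => y ^ n / n.factorial) (Real.exp y) := fun y => by
    rw [Real.exp_eq_exp_ℝ]
    exact NormedSpace.expSeries_div_hasSum_exp y
  have h2 := (hasSum_prod_pi h1 (fun y => Real.summable_pow_div_factorial y |>.norm)
    (fun i => ρ * (t i * s i))).1.mul_left (Real.exp (‖t‖ ^ 2 / 2 + ‖s‖ ^ 2 / 2))
  have hterm : ∀ α : Fin k → ℕ, Real.exp (‖t‖ ^ 2 / 2 + ‖s‖ ^ 2 / 2) *
      ∏ i, (ρ * (t i * s i)) ^ α i / ((α i).factorial : ℝ) =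
        ρ ^ (∑ i, α i) * (hermiteCoeff (fun x => Real.exp ⟪t, x⟫) α *
          hermiteCoeff (fun x => Real.exp ⟪s, x⟫) α) := by
    intro α
    rw [hermiteCoeff_exp_inner, hermiteCoeff_exp_inner, ← Finset.prod_mul_distrib,
      ← Finset.prod_pow_eq_pow_sum, ← Finset.prod_mul_distrib,
      EuclideanSpace.real_norm_sq_eq, EuclideanSpace.real_norm_sq_eq, Finset.sum_div,
      Finset.sum_div, ← Finset.sum_add_distrib, Real.exp_sum, ← Finset.prod_mul_distrib]
    refine Finset.prod_congr rfl fun i _ => ?_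
    have h0 : (0 : ℝ) < (α i).factorial := by positivity
    have h3 : (√((α i).factorial : ℝ))⁻¹ * (√((α i).factorial : ℝ))⁻¹ =
        ((α i).factorial : ℝ)⁻¹ := by
      rw [← mul_inv, Real.mul_self_sqrt h0.le]
    rw [Real.exp_add, div_eq_mul_inv _ ((α i).factorial : ℝ), ← h3, mul_pow, mul_pow]
    ring
  have hval : Real.exp (‖t‖ ^ 2 / 2 + ‖s‖ ^ 2 / 2) * ∏ i, Real.exp (ρ * (t i * s i)) =
      Real.exp (‖t‖ ^ 2 / 2 + ‖s‖ ^ 2 / 2 + ρ * ⟪t, s⟫) := by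
    rw [← Real.exp_sum, ← Real.exp_add, ← Finset.mul_sum]
    simp [PiLp.inner_apply, mul_comm]
  simpa only [hterm, hval] using h2

/-- Composition with `gaussianVec u` is an isometry of `L²`, because it preserves the Gaussian law.
Hence the integral is a bounded bilinear form, and it suffices to test on exponentials. -/
lemma hFun_hasSum {f g : EuclideanSpace ℝ (Fin k) → ℝ} (hf : MemLp f 2 (gaussianMeasure k))
    (hg : MemLp g 2 (gaussianMeasure k)) {u v : EuclideanSpace ℝ ι} (hu : ‖u‖ = 1)
    (hv : ‖v‖ = 1) :
    HasSum (fun α => ⟪u, v⟫ ^ (∑ i, α i) * (hermiteCoeff f α * hermiteCoeff g α))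
      (∫ ω, f (gaussianVec u ω) * g (gaussianVec v ω)
        ∂(stdGaussian (EuclideanSpace ℝ (ι × Fin k)))) := by
  have hJu := measurePreserving_gaussianVec (k := k) hu
  have hJv := measurePreserving_gaussianVec (k := k) hv
  have hρ : |⟪u, v⟫| ≤ 1 := by simpa [hu, hv] using abs_real_inner_le_norm u v
  have key : ∀ {f g : EuclideanSpace ℝ (Fin k) → ℝ} (hf : MemLp f 2 (gaussianMeasure k))
      (hg : MemLp g 2 (gaussianMeasure k)),
      ⟪(Lp.compMeasurePreservingₗᵢ ℝ _ hJu).toContinuousLinearMap hf.toLp,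
        (Lp.compMeasurePreservingₗᵢ ℝ _ hJv).toContinuousLinearMap hg.toLp⟫ =
      ∫ ω, f (gaussianVec u ω) * g (gaussianVec v ω)
        ∂(stdGaussian (EuclideanSpace ℝ (ι × Fin k))) := by
    intro f g hf hg
    exact inner_toLp (hf.comp_measurePreserving hJu) (hg.comp_measurePreserving hJv)
  have := Orthonormal.hasSum_inner_of_total (orthonormal_hermiteLp (k := k))
    (c := fun α => ⟪u, v⟫ ^ (∑ i, α i))
    (fun α => by rw [abs_pow]; exact pow_le_one₀ (abs_nonneg _) hρ) eq_zero_of_inner_exp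
    (Lp.compMeasurePreservingₗᵢ ℝ _ hJu).toContinuousLinearMap
    (Lp.compMeasurePreservingₗᵢ ℝ _ hJv).toContinuousLinearMap
    (fun t s => by
      rw [key, integral_exp_gaussianVec hu hv]
      simpa only [hermiteCoeff_eq_inner (memLp_exp_inner _)] using
        hasSum_hermiteCoeff_exp t s ⟪u, v⟫) hf.toLp hg.toLp
  rw [key] at this
  simpa only [hermiteCoeff_eq_inner hf, hermiteCoeff_eq_inner hg] using this

end Field

/-! ## Bounded functions and the Gaussian measure -/

section Bounded

variable {k : ℕ}

lemma pi_absolutelyContinuous {n : ℕ} {X : Type*} [MeasurableSpace X] {μ ν : Measure X}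
    [SigmaFinite μ] [SigmaFinite ν] (h : μ ≪ ν) :
    Measure.pi (fun _ : Fin n => μ) ≪ Measure.pi fun _ : Fin n => ν := by
  induction n with
  | zero => rw [Measure.pi_of_empty, Measure.pi_of_empty]
  | succ n ih =>
    rw [← (measurePreserving_piFinSuccAbove (fun _ : Fin (n + 1) => μ) 0).symm.map_eq,
      ← (measurePreserving_piFinSuccAbove (fun _ : Fin (n + 1) => ν) 0).symm.map_eq]
    exact (h.prod ih).map (MeasurableEquiv.measurable _)

lemma gaussianMeasure_absolutelyContinuous : gaussianMeasure k ≪ volume := by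
  rw [← map_toLp_pi_gaussianReal, ← (PiLp.volume_preserving_toLp (Fin k)).map_eq]
  exact (pi_absolutelyContinuous (gaussianReal_absolutelyContinuous 0 one_ne_zero)).map
    (MeasurableEquiv.measurable _)

variable {f : EuclideanSpace ℝ (Fin k) → ℝ}

lemma normInfty_nonneg : 0 ≤ normInfty f := ENNReal.toReal_nonneg

lemma ae_abs_le_normInfty (hf : MemLp f ∞ volume) :
    ∀ᵐ x ∂(gaussianMeasure k), |f x| ≤ normInfty f := by
  refine gaussianMeasure_absolutelyContinuous.ae_le ?_
  have h := hf.2.ne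
  filter_upwards [enorm_ae_le_eLpNormEssSup f volume] with x hx
  rw [← eLpNorm_exponent_top] at hx
  simpa [normInfty] using ENNReal.toReal_mono h hx

lemma memLp_two_gaussianMeasure (hf : MemLp f ∞ volume) : MemLp f 2 (gaussianMeasure k) :=
  MemLp.of_bound (hf.1.mono_ac gaussianMeasure_absolutelyContinuous) (normInfty f)
    (ae_abs_le_normInfty hf)

end Bounded

/-! ## Gram matrices -/

section Gram

lemma exists_gram_of_posSemidef {κ : Type*} [Finite κ] {M : Matrix κ κ ℝ} (hM : M.PosSemidef) :
    ∃ (N : ℕ) (w : κ → EuclideanSpace ℝ (Fin N)), ∀ i j, M i j = ⟪w i, w j⟫ := by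
  obtain ⟨N, v, rfl⟩ := Matrix.posSemidef_iff_eq_sum_vecMulVec.1 hM
  refine ⟨N, fun i => WithLp.toLp 2 fun l => v l i, fun i j => ?_⟩
  simp [Matrix.sum_apply, Matrix.vecMulVec_apply, PiLp.inner_apply, mul_comm]

lemma norm_eq_one_of_inner_self {E : Type*} [NormedAddCommGroup E] [InnerProductSpace ℝ E] {x : E}
    (h : ⟪x, x⟫ = 1) : ‖x‖ = 1 := by
  rw [real_inner_self_eq_norm_sq] at h
  exact (pow_eq_one_iff_of_nonneg (norm_nonneg _) two_ne_zero).1 h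

/-- The Gram matrix of two families joined together. -/
def jointGram {H : Type*} [NormedAddCommGroup H] [InnerProductSpace ℝ H] {m n : ℕ}
    (u : Fin m → H) (v : Fin n → H) : Matrix (Fin m ⊕ Fin n) (Fin m ⊕ Fin n) ℝ :=
  Matrix.gram ℝ (Sum.elim u v)

lemma exists_euclidean_of_posSemidef {m n : ℕ}
    {M : Matrix (Fin m ⊕ Fin n) (Fin m ⊕ Fin n) ℝ} (hM : M.PosSemidef) (h1 : ∀ i, M i i = 1) :
    ∃ (N : ℕ) (u : Fin m → EuclideanSpace ℝ (Fin N)) (v : Fin n → EuclideanSpace ℝ (Fin N)),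
      (∀ i, ‖u i‖ = 1) ∧ (∀ j, ‖v j‖ = 1) ∧ ∀ i j, M (.inl i) (.inr j) = ⟪u i, v j⟫ := by
  obtain ⟨N, w, hw⟩ := exists_gram_of_posSemidef hM
  exact ⟨N, fun i => w (.inl i), fun j => w (.inr j),
    fun i => norm_eq_one_of_inner_self (by rw [← hw, h1]),
    fun j => norm_eq_one_of_inner_self (by rw [← hw, h1]), fun i j => hw _ _⟩

/-- Only the finite Gram matrix of the joined families matters. It is realised again in finite
dimension, where finitely many Gaussian vectors suffice. -/
lemma IsQuantumCorrelation.exists_euclidean {m n : ℕ} {S : Matrix (Fin m) (Fin n) ℝ}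
    (hS : IsQuantumCorrelation S) :
    ∃ (N : ℕ) (u : Fin m → EuclideanSpace ℝ (Fin N)) (v : Fin n → EuclideanSpace ℝ (Fin N)),
      (∀ i, ‖u i‖ = 1) ∧ (∀ j, ‖v j‖ = 1) ∧ ∀ i j, S i j = ⟪u i, v j⟫ := by
  obtain ⟨H, _, _, _, u, v, hu, hv, rfl⟩ := hS
  obtain ⟨N, u', v', hu', hv', h⟩ := exists_euclidean_of_posSemidef (M := jointGram u v)
    (Matrix.posSemidef_gram ℝ _) (by rintro (i | i) <;> simp [jointGram, Matrix.gram_apply, hu, hv])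
  refine ⟨N, u', v', hu', hv', fun i j => ?_⟩
  rw [← h]
  simp [jointGram, Matrix.gram_apply, gramMatrix, real_inner_comm]

end Gram

/-! ## The norm of a matrix as an operator from `ℓ_∞` to `ℓ_1` -/

section NormInftyOne

variable {m n : ℕ} (A : Matrix (Fin m) (Fin n) ℝ)

lemma normInftyOne_nonneg : 0 ≤ normInftyOne A := norm_nonneg _

lemma sum_abs_mulVec_le {z : Fin n → ℝ} {c : ℝ} (hc : 0 ≤ c) (hz : ∀ j, |z j| ≤ c) :
    ∑ i, |A.mulVec z i| ≤ normInftyOne A * c := by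
  have h := (LinearMap.toContinuousLinearMap
    ((WithLp.linearEquiv 1 ℝ (Fin m → ℝ)).symm.toLinearMap ∘ₗ Matrix.toLin' A)).le_opNorm z
  rw [PiLp.norm_eq_of_L1] at h
  refine le_trans (le_of_eq ?_) (h.trans (mul_le_mul_of_nonneg_left ?_ (norm_nonneg _)))
  · simp
  · exact (pi_norm_le_iff_of_nonneg hc).2 hz

variable {A} in
lemma normInftyOne_le {M : ℝ} (hM : 0 ≤ M)
    (h : ∀ z : Fin n → ℝ, ∑ i, |A.mulVec z i| ≤ M * ‖z‖) : normInftyOne A ≤ M := by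
  refine ContinuousLinearMap.opNorm_le_bound _ hM fun z => ?_
  rw [PiLp.norm_eq_of_L1]
  simpa using h z

lemma trace_transpose_mul_eq_sum (S : Matrix (Fin m) (Fin n) ℝ) :
    (A.transpose * S).trace = ∑ i, ∑ j, A i j * S i j := by
  rw [Finset.sum_comm]
  simp [Matrix.trace, Matrix.mul_apply]

lemma normInftyOne_scale_le {x : Fin m → ℝ} {y : Fin n → ℝ} {c d : ℝ} (hc : 0 ≤ c) (hd : 0 ≤ d)
    (hx : ∀ i, |x i| ≤ c) (hy : ∀ j, |y j| ≤ d) :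
    normInftyOne (Matrix.of fun i j => A i j * (x i * y j)) ≤ c * d * normInftyOne A := by
  refine normInftyOne_le (mul_nonneg (mul_nonneg hc hd) (normInftyOne_nonneg A)) fun z => ?_
  have h1 : ∀ i, (Matrix.of fun i j => A i j * (x i * y j)).mulVec z i =
      x i * A.mulVec (fun j => y j * z j) i := fun i => by
    simp only [Matrix.mulVec, dotProduct, Matrix.of_apply, Finset.mul_sum]
    exact Finset.sum_congr rfl fun j _ => by ring
  have h2 := sum_abs_mulVec_le A (z := fun j => y j * z j) (mul_nonneg hd (norm_nonneg z))
    fun j => by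
      rw [abs_mul]
      exact mul_le_mul (hy j) (norm_le_pi_norm z j) (abs_nonneg _) hd
  calc ∑ i, |(Matrix.of fun i j => A i j * (x i * y j)).mulVec z i|
      ≤ ∑ i, c * |A.mulVec (fun j => y j * z j) i| := by
        refine Finset.sum_le_sum fun i _ => ?_
        rw [h1, abs_mul]
        exact mul_le_mul_of_nonneg_right (hx i) (abs_nonneg _)
    _ ≤ c * (normInftyOne A * (d * ‖z‖)) := by
        rw [← Finset.mul_sum]
        exact mul_le_mul_of_nonneg_left h2 hc
    _ = c * d * normInftyOne A * ‖z‖ := by ring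

/-- The pairing of `T` with matrices is bounded by `C` times the norm from `ℓ_∞` to `ℓ_1`. -/
def DualBound {m n : ℕ} (T : Matrix (Fin m) (Fin n) ℝ) (C : ℝ) : Prop :=
  ∀ A : Matrix (Fin m) (Fin n) ℝ, |(A.transpose * T).trace| ≤ C * normInftyOne A

lemma dualBound_one : DualBound (Matrix.of fun (_ : Fin m) (_ : Fin n) => (1 : ℝ)) 1 := by
  intro A
  rw [trace_transpose_mul_eq_sum, one_mul]
  refine (Finset.abs_sum_le_sum_abs _ _).trans ?_
  have h := sum_abs_mulVec_le A (z := fun _ => 1) zero_le_one (fun _ => by simp)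
  simpa [Matrix.mulVec, dotProduct] using h

end NormInftyOne

/-! ## The inequalities for correlation matrices -/

section Inequalities

variable {k : ℕ} {f g : EuclideanSpace ℝ (Fin k) → ℝ}

lemma hFun_inner {ι : Type*} [Fintype ι] (hf : MemLp f ∞ volume) (hg : MemLp g ∞ volume)
    {u v : EuclideanSpace ℝ ι} (hu : ‖u‖ = 1) (hv : ‖v‖ = 1) :
    hFun f g ⟪u, v⟫ = ∫ ω, f (gaussianVec u ω) * g (gaussianVec v ω)
        ∂(stdGaussian (EuclideanSpace ℝ (ι × Fin k))) := by
  rw [← (hFun_hasSum (memLp_two_gaussianMeasure hf) (memLp_two_gaussianMeasure hg) hu hv).tsum_eq]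
  exact tsum_congr fun α => mul_comm _ _

lemma integrable_gaussianVec_mul {ι : Type*} [Fintype ι] (hf : MemLp f ∞ volume)
    (hg : MemLp g ∞ volume) {u v : EuclideanSpace ℝ ι} (hu : ‖u‖ = 1) (hv : ‖v‖ = 1) :
    Integrable (fun ω => f (gaussianVec u ω) * g (gaussianVec v ω))
      (stdGaussian (EuclideanSpace ℝ (ι × Fin k))) :=
  ((memLp_two_gaussianMeasure hf).comp_measurePreserving
    (measurePreserving_gaussianVec hu)).integrable_mul
    ((memLp_two_gaussianMeasure hg).comp_measurePreserving (measurePreserving_gaussianVec hv))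

lemma ae_gaussianVec_le {ι κ : Type*} [Fintype ι] [Countable κ] (hf : MemLp f ∞ volume)
    {u : κ → EuclideanSpace ℝ ι} (hu : ∀ i, ‖u i‖ = 1) :
    ∀ᵐ ω ∂(stdGaussian (EuclideanSpace ℝ (ι × Fin k))),
      ∀ i, |f (gaussianVec (u i) ω)| ≤ normInfty f :=
  ae_all_iff.2 fun i => (measurePreserving_gaussianVec (hu i)).quasiMeasurePreserving.ae
    (ae_abs_le_normInfty hf)

lemma sum_hFun_eq_integral {ι : Type*} [Fintype ι] {m n : ℕ} (hf : MemLp f ∞ volume)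
    (hg : MemLp g ∞ volume) (A : Matrix (Fin m) (Fin n) ℝ) {u : Fin m → EuclideanSpace ℝ ι}
    {v : Fin n → EuclideanSpace ℝ ι} (hu : ∀ i, ‖u i‖ = 1) (hv : ∀ j, ‖v j‖ = 1) :
    ∑ i, ∑ j, A i j * hFun f g ⟪u i, v j⟫ =
      ∫ ω, ∑ i, ∑ j, A i j * (f (gaussianVec (u i) ω) * g (gaussianVec (v j) ω))
        ∂(stdGaussian (EuclideanSpace ℝ (ι × Fin k))) := by
  have h : ∀ i j, Integrable
      (fun ω => A i j * (f (gaussianVec (u i) ω) * g (gaussianVec (v j) ω)))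
      (stdGaussian (EuclideanSpace ℝ (ι × Fin k))) :=
    fun i j => (integrable_gaussianVec_mul hf hg (hu i) (hv j)).const_mul _
  rw [integral_finsetSum _ fun i _ => integrable_finsetSum _ fun j _ => h i j]
  refine Finset.sum_congr rfl fun i _ => ?_
  rw [integral_finsetSum _ fun j _ => h i j]
  refine Finset.sum_congr rfl fun j _ => ?_
  rw [integral_const_mul, hFun_inner hf hg (hu i) (hv j)]

lemma abs_integral_le_of_ae_le {Ω : Type*} [MeasurableSpace Ω] {μ : Measure Ω}
    [IsProbabilityMeasure μ] {F : Ω → ℝ} {C : ℝ} (h : ∀ᵐ ω ∂μ, |F ω| ≤ C) :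
    |∫ ω, F ω ∂μ| ≤ C := by
  simpa using norm_integral_le_of_norm_le_const (f := F) (μ := μ) h

/-- For almost every `ω`, the values of `f` and `g` only rescale the rows and columns of `A`, which
costs at most `normInfty f * normInfty g`. The extra factor `T` makes the bound iterable, so that
entrywise powers are covered. -/
lemma DualBound.hadamard_hFun (hf : MemLp f ∞ volume) (hg : MemLp g ∞ volume) {m n : ℕ}
    {T S : Matrix (Fin m) (Fin n) ℝ} {C : ℝ} (hC : 0 ≤ C) (hT : DualBound T C)
    (hS : IsQuantumCorrelation S) :
    DualBound (T.hadamard (S.map (hFun f g))) (C * (normInfty f * normInfty g)) := by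
  intro A
  obtain ⟨N, u, v, hu, hv, h⟩ := hS.exists_euclidean
  have h1 : (A.transpose * T.hadamard (S.map (hFun f g))).trace =
      ∑ i, ∑ j, (A.hadamard T) i j * hFun f g ⟪u i, v j⟫ := by
    simp only [trace_transpose_mul_eq_sum, Matrix.hadamard_apply, Matrix.map_apply, h, mul_assoc]
  rw [h1, sum_hFun_eq_integral hf hg _ hu hv]
  refine abs_integral_le_of_ae_le ?_
  filter_upwards [ae_gaussianVec_le hf hu, ae_gaussianVec_le hg hv] with ω hx hy
  have h2 := hT (Matrix.of fun i j =>
    A i j * (f (gaussianVec (u i) ω) * g (gaussianVec (v j) ω)))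
  have h3 := normInftyOne_scale_le A normInfty_nonneg normInfty_nonneg hx hy
  rw [trace_transpose_mul_eq_sum] at h2
  have h4 : ∑ i, ∑ j, (A.hadamard T) i j * (f (gaussianVec (u i) ω) * g (gaussianVec (v j) ω)) =
      ∑ i, ∑ j, (Matrix.of fun i j =>
        A i j * (f (gaussianVec (u i) ω) * g (gaussianVec (v j) ω))) i j * T i j := by
    refine Finset.sum_congr rfl fun i _ => Finset.sum_congr rfl fun j _ => ?_
    simp only [Matrix.hadamard_apply, Matrix.of_apply]
    ring
  rw [h4]
  calc _ ≤ _ := h2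
    _ ≤ C * (normInfty f * normInfty g * normInftyOne A) := mul_le_mul_of_nonneg_left h3 hC
    _ = _ := by ring

lemma dualBound_map_hFun_pow (hf : MemLp f ∞ volume) (hg : MemLp g ∞ volume) {m n : ℕ}
    {S : Matrix (Fin m) (Fin n) ℝ} (hS : IsQuantumCorrelation S) (l : ℕ) :
    DualBound (S.map fun s => hFun f g s ^ l) ((normInfty f * normInfty g) ^ l) := by
  induction l with
  | zero => simpa [Matrix.map] using dualBound_one
  | succ l ih =>
    have h := ih.hadamard_hFun hf hg
      (pow_nonneg (mul_nonneg normInfty_nonneg normInfty_nonneg) l) hS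
    rw [← pow_succ] at h
    convert h using 1
    ext i j
    simp [pow_succ]

lemma dualBound_map_hFun (hf : MemLp f ∞ volume) (hg : MemLp g ∞ volume) {m n : ℕ}
    {S : Matrix (Fin m) (Fin n) ℝ} (hS : IsQuantumCorrelation S) :
    DualBound (S.map (hFun f g)) (normInfty f * normInfty g) := by
  simpa using dualBound_map_hFun_pow hf hg hS 1

lemma abs_dotProduct_mulVec_le_of_scale {n : ℕ} (A : Matrix (Fin n) (Fin n) ℝ) {M c : ℝ}
    (hc : 0 ≤ c) (hM : ∀ x : Fin n → ℝ, (∀ i, x i ∈ Icc (-1 : ℝ) 1) → |x ⬝ᵥ A.mulVec x| ≤ M)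
    {x : Fin n → ℝ} (hx : ∀ i, |x i| ≤ c) : |x ⬝ᵥ A.mulVec x| ≤ c ^ 2 * M := by
  rcases hc.eq_or_lt with rfl | hc
  · have : x = 0 := funext fun i => abs_nonpos_iff.1 (hx i)
    simp [this]
  · have h := hM (c⁻¹ • x) fun i => by
      rw [mem_Icc, ← abs_le, Pi.smul_apply, smul_eq_mul, abs_mul, abs_of_pos (inv_pos.2 hc)]
      exact (mul_le_mul_of_nonneg_left (hx i) (inv_pos.2 hc).le).trans_eq (inv_mul_cancel₀ hc.ne')
    have h2 : x ⬝ᵥ A.mulVec x = c ^ 2 * ((c⁻¹ • x) ⬝ᵥ A.mulVec (c⁻¹ • x)) := by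
      rw [Matrix.mulVec_smul, smul_dotProduct, dotProduct_smul, smul_eq_mul, smul_eq_mul]
      field_simp
    rw [h2, abs_mul, abs_of_nonneg (sq_nonneg c)]
    exact mul_le_mul_of_nonneg_left h (sq_nonneg c)

lemma exists_isGreatest_and_abs_trace_le (hf : MemLp f ∞ volume) {n : ℕ}
    (A S : Matrix (Fin n) (Fin n) ℝ) (hS : IsCorrelation S) :
    ∃ M : ℝ, IsGreatest ((fun x : Fin n → ℝ => |x ⬝ᵥ A.mulVec x|) ''
        {x | ∀ i, x i ∈ Icc (-1 : ℝ) 1}) M ∧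
      |(A.transpose * S.map (hFun f f)).trace| ≤ normInfty f ^ 2 * M := by
  have hK : IsCompact {x : Fin n → ℝ | ∀ i, x i ∈ Icc (-1 : ℝ) 1} :=
    isCompact_pi_infinite fun _ => isCompact_Icc
  have hcont : ContinuousOn (fun x : Fin n → ℝ => |x ⬝ᵥ A.mulVec x|)
      {x : Fin n → ℝ | ∀ i, x i ∈ Icc (-1 : ℝ) 1} := by
    simp only [Matrix.mulVec, dotProduct]
    fun_prop
  obtain ⟨M, hM⟩ := (hK.image_of_continuousOn hcont).exists_isGreatest
    (Set.Nonempty.image _ ⟨0, fun i => by simp⟩)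
  refine ⟨M, hM, ?_⟩
  obtain ⟨N, w, hw⟩ := exists_gram_of_posSemidef hS.1
  have hw1 : ∀ i, ‖w i‖ = 1 := fun i => norm_eq_one_of_inner_self (by rw [← hw, hS.2])
  rw [trace_transpose_mul_eq_sum]
  simp only [Matrix.map_apply, hw]
  rw [sum_hFun_eq_integral hf hf _ hw1 hw1]
  refine abs_integral_le_of_ae_le ?_
  filter_upwards [ae_gaussianVec_le hf hw1] with ω hx
  convert abs_dotProduct_mulVec_le_of_scale A normInfty_nonneg
    (fun x hx => hM.2 ⟨x, hx, rfl⟩) hx using 2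
  simp only [Matrix.mulVec, dotProduct, Finset.mul_sum]
  exact Finset.sum_congr rfl fun i _ => Finset.sum_congr rfl fun j _ => by ring

end Inequalities

/-! ## Odd injective functions on `[-1, 1]` -/

section OddInjective

variable {h : ℝ → ℝ} (hc : ContinuousOn h (Icc (-1) 1))
  (hodd : ∀ ρ ∈ Icc (-1 : ℝ) 1, h (-ρ) = -h ρ) (hinj : InjOn h (Icc (-1) 1))

include hc hinj in
lemma strictMonoOn_or_strictAntiOn :
    StrictMonoOn h (Icc (-1) 1) ∨ StrictAntiOn h (Icc (-1) 1) :=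
  hc.strictMonoOn_of_injOn_Icc' (by norm_num) hinj

include hodd in
lemma odd_apply_zero : h 0 = 0 := by
  have := hodd 0 (by simp)
  simp at this
  linarith

include hodd hinj in
lemma max_neg_apply_one_pos : 0 < max (-h 1) (h 1) := by
  have : h 1 ≠ 0 := fun h1 => by
    have := hinj (by simp) (by simp) (h1.trans (odd_apply_zero hodd).symm)
    norm_num at this
  rcases lt_or_gt_of_ne this with h1 | h1
  · exact lt_max_of_lt_left (by linarith)
  · exact lt_max_of_lt_right h1

include hc hodd hinj in
lemma mapsTo_Icc : MapsTo h (Icc (-1) 1) (Icc (-max (-h 1) (h 1)) (max (-h 1) (h 1))) := by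
  have hm1 : h (-1) = -h 1 := hodd 1 (by simp)
  intro ρ hρ
  have hl : (-1 : ℝ) ∈ Icc (-1 : ℝ) 1 := by simp
  have hr : (1 : ℝ) ∈ Icc (-1 : ℝ) 1 := by simp
  rcases strictMonoOn_or_strictAntiOn hc hinj with hm | hm
  · have h1 := hm.monotoneOn hl hρ hρ.1
    have h2 := hm.monotoneOn hρ hr hρ.2
    exact ⟨by linarith [le_max_right (-h 1) (h 1)], by linarith [le_max_right (-h 1) (h 1)]⟩
  · have h1 := hm.antitoneOn hl hρ hρ.1
    have h2 := hm.antitoneOn hρ hr hρ.2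
    exact ⟨by linarith [le_max_left (-h 1) (h 1)], by linarith [le_max_left (-h 1) (h 1)]⟩

include hc hodd hinj in
lemma image_Icc_eq : h '' Icc (-1) 1 = Icc (-max (-h 1) (h 1)) (max (-h 1) (h 1)) := by
  have hm1 : h (-1) = -h 1 := hodd 1 (by simp)
  refine Subset.antisymm (mapsTo_Icc hc hodd hinj).image_subset ?_
  rcases le_total 0 (h 1) with h1 | h1
  · rw [max_eq_right (by linarith), ← hm1]
    exact intermediate_value_Icc (by norm_num) hc
  · rw [max_eq_left (by linarith), neg_neg, ← hm1]
    exact intermediate_value_Icc' (by norm_num) hc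

include hc hodd hinj in
lemma mapsTo_Ioo : MapsTo h (Ioo (-1) 1) (Ioo (-max (-h 1) (h 1)) (max (-h 1) (h 1))) := by
  have hm1 : h (-1) = -h 1 := hodd 1 (by simp)
  intro ρ hρ
  have h1 := mapsTo_Icc hc hodd hinj (Ioo_subset_Icc_self hρ)
  have hne : ∀ ε : ℝ, ε ∈ Icc (-1 : ℝ) 1 → ρ ≠ ε → h ρ ≠ h ε := fun ε hε hne heq =>
    hne (hinj (Ioo_subset_Icc_self hρ) hε heq)
  have h2 := hne 1 (by simp) hρ.2.ne
  have h3 := hne (-1) (by simp) hρ.1.ne'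
  rw [hm1] at h3
  refine ⟨lt_of_le_of_ne h1.1 fun h4 => ?_, lt_of_le_of_ne h1.2 fun h4 => ?_⟩
  · rcases max_choice (-h 1) (h 1) with h5 | h5 <;> rw [h5] at h4
    · exact h2 (by linarith)
    · exact h3 h4.symm
  · rcases max_choice (-h 1) (h 1) with h5 | h5 <;> rw [h5] at h4
    · exact h3 h4
    · exact h2 h4

include hc hodd hinj in
lemma exists_homeomorph :
    ∃ e : Icc (-1 : ℝ) 1 ≃ₜ Icc (-max (-h 1) (h 1)) (max (-h 1) (h 1)),
      ∀ ρ : Icc (-1 : ℝ) 1, (e ρ : ℝ) = h ρ := by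
  have hb : BijOn h (Icc (-1) 1) (Icc (-max (-h 1) (h 1)) (max (-h 1) (h 1))) := by
    rw [← image_Icc_eq hc hodd hinj]
    exact hinj.bijOn_image
  have hcont : Continuous (hb.equiv h) :=
    (continuousOn_iff_continuous_domRestrict.1 hc).subtype_mk _
  exact ⟨hcont.homeoOfEquivCompactToT2, fun ρ => rfl⟩

end OddInjective

/-! ## Power series with absolutely summable coefficients -/

section PowerSeries

variable {b : ℕ → ℝ} {r : ℝ}

lemma continuousOn_tsum_mul_pow (hs : Summable fun n => |b n| * r ^ n) :
    ContinuousOn (fun x => ∑' n, b n * x ^ n) (Icc (-r) r) := by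
  refine continuousOn_tsum (fun n => by fun_prop) hs fun n x hx => ?_
  rw [norm_mul, norm_pow, Real.norm_eq_abs, Real.norm_eq_abs]
  gcongr
  exact abs_le.2 hx

lemma summable_abs_mul_pow (hs : Summable fun n => |b n| * r ^ n) {x : ℝ} (hx : |x| ≤ r) :
    Summable fun n => |b n| * |x| ^ n :=
  Summable.of_nonneg_of_le (fun _ => by positivity) (fun n => by gcongr) hs

/-- Real analyticity alone gives the Taylor expansion only near `0`. Summability makes the radius of
convergence at least `r`, and the identity theorem propagates the equality to the whole interval. -/
lemma eqOn_tsum_of_analyticOnNhd {ψ : ℝ → ℝ} (hr : 0 < r) (hψ : AnalyticOnNhd ℝ ψ (Ioo (-r) r))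
    (hs : Summable fun n => |iteratedDeriv n ψ 0 / n.factorial| * r ^ n) :
    EqOn ψ (fun x => ∑' n, iteratedDeriv n ψ 0 / n.factorial * x ^ n) (Ioo (-r) r) := by
  set p := FormalMultilinearSeries.ofScalars ℝ fun n => iteratedDeriv n ψ 0 / n.factorial with hp
  have hrad : ENNReal.ofReal r ≤ p.radius := by
    refine p.le_radius_of_summable (r := r.toNNReal) ?_
    simpa only [hp, FormalMultilinearSeries.ofScalars_norm, Real.norm_eq_abs,
      Real.coe_toNNReal r hr.le] using hs
  have hsum : ∀ x, p.sum x = ∑' n, iteratedDeriv n ψ 0 / n.factorial * x ^ n := fun x => by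
    exact FormalMultilinearSeries.ofScalars_sum_eq (E := ℝ)
      (fun n => iteratedDeriv n ψ 0 / n.factorial) x
  have hball := p.hasFPowerSeriesOnBall ((ENNReal.ofReal_pos.2 hr).trans_le hrad)
  have hsub : Ioo (-r) r ⊆ Metric.eball 0 p.radius := fun x hx => by
    refine Metric.eball_subset_eball hrad ?_
    rw [Metric.eball_ofReal, Metric.mem_ball, Real.dist_0_eq_abs]
    exact abs_lt.2 hx
  have h0 : (0 : ℝ) ∈ Ioo (-r) r := by simp [hr]
  have hloc : ψ =ᶠ[nhds 0] p.sum := by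
    have h1 := ((hψ 0 h0).hasFPowerSeriesAt).eventually_hasSum
    have h2 := hball.hasFPowerSeriesAt.eventually_hasSum
    filter_upwards [h1, h2] with y hy1 hy2
    simpa using hy1.unique hy2
  have := hψ.eqOn_of_preconnected_of_eventuallyEq (hball.analyticOnNhd.mono hsub)
    isPreconnected_Ioo h0 hloc
  intro x hx
  rw [this hx, hsum]

variable (hs : Summable fun n => |b n| * r ^ n)

include hs in
lemma strictMonoOn_tsum_abs_mul_pow {n₀ : ℕ} (hn₀ : n₀ ≠ 0) (hb : b n₀ ≠ 0) :
    StrictMonoOn (fun x => ∑' n, |b n| * x ^ n) (Icc 0 r) := by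
  intro x hx y hy hxy
  have hsm : ∀ {x : ℝ}, x ∈ Icc 0 r → Summable fun n => |b n| * x ^ n := fun {x} hx => by
    simpa [abs_of_nonneg hx.1] using
      summable_abs_mul_pow hs (x := x) (by rw [abs_of_nonneg hx.1]; exact hx.2)
  refine Summable.tsum_lt_tsum (i := n₀) (fun n => ?_) ?_ (hsm hx) (hsm hy)
  · exact mul_le_mul_of_nonneg_left (pow_le_pow_left₀ hx.1 hxy.le n) (abs_nonneg _)
  · exact mul_lt_mul_of_pos_left (pow_lt_pow_left₀ hxy hx.1 hn₀) (abs_pos.2 hb)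

end PowerSeries

/-! ## Krivine's change of vectors -/

section Krivine

lemma posSemidef_map_pow {κ : Type*} [Finite κ] {M : Matrix κ κ ℝ} (hM : M.PosSemidef) (n : ℕ) :
    (M.map (· ^ n)).PosSemidef := by
  induction n with
  | zero =>
    have h : M.map (· ^ 0) = Matrix.vecMulVec (fun _ => (1 : ℝ)) (star fun _ => (1 : ℝ)) := by
      ext i j
      simp [Matrix.vecMulVec_apply]
    rw [h]
    exact Matrix.posSemidef_vecMulVec_self_star _
  | succ n ih =>
    have h : M.map (· ^ (n + 1)) = (M.map (· ^ n)).hadamard M := by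
      ext i j
      simp [pow_succ]
    rw [h]
    exact ih.hadamard hM

lemma posSemidef_of_hasSum {κ : Type*} [Fintype κ] {T : ℕ → Matrix κ κ ℝ} {M : Matrix κ κ ℝ}
    (hT : ∀ n, (T n).PosSemidef) (h : ∀ i j, HasSum (fun n => T n i j) (M i j)) :
    M.PosSemidef := by
  refine .of_dotProduct_mulVec_nonneg ?_ fun x => ?_
  · ext i j
    rw [Matrix.conjTranspose_apply, star_trivial]
    refine (h j i).unique ?_
    convert h i j using 2 with n
    simpa using (hT n).1.apply i j
  · have : HasSum (fun n => star x ⬝ᵥ (T n).mulVec x) (star x ⬝ᵥ M.mulVec x) := by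
      simp only [Matrix.mulVec, dotProduct]
      exact hasSum_sum fun i _ => (hasSum_sum fun j _ => (h i j).mul_right _).mul_left _
    exact this.nonneg fun n => (hT n).dotProduct_mulVec_nonneg x

lemma isQuantumCorrelation_of_euclidean {m n N : ℕ} {S : Matrix (Fin m) (Fin n) ℝ}
    {u : Fin m → EuclideanSpace ℝ (Fin N)} {v : Fin n → EuclideanSpace ℝ (Fin N)}
    (hu : ∀ i, ‖u i‖ = 1) (hv : ∀ j, ‖v j‖ = 1) (h : ∀ i j, S i j = ⟪u i, v j⟫) :
    IsQuantumCorrelation S := by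
  refine ⟨EuclideanSpace ℝ (Fin N), inferInstance, inferInstance, inferInstance, u, v, hu, hv, ?_⟩
  ext i j
  rw [h, gramMatrix, Matrix.of_apply, real_inner_comm]

/-- Krivine's lemma: a power series with coefficients of total absolute weight one maps quantum
correlation matrices to quantum correlation matrices. -/
lemma IsQuantumCorrelation.map_tsum {m n : ℕ} {S : Matrix (Fin m) (Fin n) ℝ}
    (hS : IsQuantumCorrelation S) {b : ℕ → ℝ} {c : ℝ} (hc : 0 ≤ c)
    (hb : HasSum (fun l => |b l| * c ^ l) 1) :
    IsQuantumCorrelation (S.map fun s => ∑' l, b l * (c * s) ^ l) := by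
  obtain ⟨N, u, v, hu, hv, h⟩ := hS.exists_euclidean
  let w : Fin m ⊕ Fin n → EuclideanSpace ℝ (Fin N) := Sum.elim u v
  have hw : ∀ i, ‖w i‖ = 1 := by rintro (i | i) <;> simp [w, hu, hv]
  -- The sign of `b l` is carried by the second family only. The rank-one matrix of signs is
  -- positive semidefinite, has ones on the diagonal, and equals the sign of `b l` on the
  -- off-diagonal block. So the weights `|b l| * c ^ l` give unit diagonal while that block carries
  -- `b l * c ^ l`.
  let σ : ℕ → Fin m ⊕ Fin n → ℝ := fun l =>
    Sum.elim (fun _ => 1) (fun _ => if b l < 0 then -1 else 1)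
  have hσ : ∀ l i, σ l i = 1 ∨ σ l i = -1 := by
    rintro l (i | i)
    · simp [σ]
    · by_cases hl : b l < 0 <;> simp [σ, hl]
  have hσ2 : ∀ l i, σ l i * σ l i = 1 := fun l i => by rcases hσ l i with h | h <;> simp [h]
  have hσ1 : ∀ l i j, |σ l i * σ l j| ≤ 1 := fun l i j => by
    rcases hσ l i with h | h <;> rcases hσ l j with h' | h' <;> simp [h, h']
  let T : ℕ → Matrix (Fin m ⊕ Fin n) (Fin m ⊕ Fin n) ℝ := fun l =>
    (|b l| * c ^ l) • (Matrix.vecMulVec (σ l) (star (σ l))).hadamard ((Matrix.gram ℝ w).map (· ^ l))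
  have hTapp : ∀ l i j, T l i j = |b l| * c ^ l * (σ l i * σ l j * ⟪w i, w j⟫ ^ l) := fun l i j => by
    simp [T, Matrix.vecMulVec_apply, Matrix.gram_apply]
  have hTpos : ∀ l, (T l).PosSemidef := fun l =>
    ((Matrix.posSemidef_vecMulVec_self_star (σ l)).hadamard
      (posSemidef_map_pow (Matrix.posSemidef_gram ℝ w) l)).smul (by positivity)
  have hsum : ∀ i j, Summable fun l => T l i j := fun i j => by
    refine Summable.of_norm_bounded hb.summable fun l => ?_
    have hin : |⟪w i, w j⟫| ≤ 1 := by simpa [hw] using abs_real_inner_le_norm (w i) (w j)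
    have h1 : 0 ≤ |b l| * c ^ l := by positivity
    rw [hTapp, Real.norm_eq_abs, abs_mul, abs_of_nonneg h1, abs_mul, abs_pow]
    exact mul_le_of_le_one_right h1
      (mul_le_one₀ (hσ1 l i j) (by positivity) (pow_le_one₀ (abs_nonneg _) hin))
  obtain ⟨N', u', v', hu', hv', h'⟩ := exists_euclidean_of_posSemidef
    (M := Matrix.of fun i j => ∑' l, T l i j)
    (posSemidef_of_hasSum hTpos fun i j => (hsum i j).hasSum) (fun i => by
      simp only [Matrix.of_apply, hTapp, hσ2, real_inner_self_eq_norm_sq, hw]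
      simpa using hb.tsum_eq)
  refine isQuantumCorrelation_of_euclidean hu' hv' fun i j => ?_
  rw [← h', Matrix.map_apply, Matrix.of_apply, h]
  refine tsum_congr fun l => ?_
  rw [hTapp]
  by_cases hl : b l < 0
  · simp only [σ, w, Sum.elim_inl, Sum.elim_inr, hl, if_true, abs_of_neg hl, mul_pow]
    ring
  · simp only [σ, w, Sum.elim_inl, Sum.elim_inr, hl, if_false, abs_of_nonneg (not_lt.1 hl), mul_pow]
    ring

end Krivine

/-! ## Properties of `h_{f,g}` -/

section HFun

variable {k : ℕ} {f g : EuclideanSpace ℝ (Fin k) → ℝ}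

lemma exists_unit_inner_eq {ρ : ℝ} (hρ : ρ ∈ Icc (-1 : ℝ) 1) :
    ∃ u v : EuclideanSpace ℝ (Fin 2), ‖u‖ = 1 ∧ ‖v‖ = 1 ∧ ⟪u, v⟫ = ρ := by
  have h : 0 ≤ 1 - ρ ^ 2 := by nlinarith [hρ.1, hρ.2]
  refine ⟨!₂[1, 0], !₂[ρ, √(1 - ρ ^ 2)], ?_, ?_, ?_⟩
  · simp [EuclideanSpace.norm_eq]
  · simp [EuclideanSpace.norm_eq, Real.sq_sqrt h]
  · simp [PiLp.inner_apply]

/-- Changing the sign of one unit vector changes the sign both of the inner product and of its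
Gaussian vector; oddness of the corresponding function then gives the sign of the integral. -/
lemma hFun_neg (hf : MemLp f ∞ volume) (hg : MemLp g ∞ volume) (hodd : IsOddAE f ∨ IsOddAE g)
    {ρ : ℝ} (hρ : ρ ∈ Icc (-1 : ℝ) 1) : hFun f g (-ρ) = -hFun f g ρ := by
  obtain ⟨u, v, hu, hv, rfl⟩ := exists_unit_inner_eq hρ
  have hae : ∀ {f : EuclideanSpace ℝ (Fin k) → ℝ}, IsOddAE f → ∀ {u : EuclideanSpace ℝ (Fin 2)},
      ‖u‖ = 1 → ∀ᵐ ω ∂(stdGaussian (EuclideanSpace ℝ (Fin 2 × Fin k))),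
        f (gaussianVec (-u) ω) = -f (gaussianVec u ω) := by
    intro f hf u hu
    simp only [gaussianVec_neg]
    exact (measurePreserving_gaussianVec hu).quasiMeasurePreserving.ae
      (gaussianMeasure_absolutelyContinuous.ae_le hf)
  rw [hFun_inner hf hg hu hv, ← integral_neg]
  rcases hodd with h | h
  · rw [← inner_neg_left, hFun_inner hf hg (by rwa [norm_neg]) hv]
    refine integral_congr_ae ?_
    filter_upwards [hae h hu] with ω hω
    rw [hω, neg_mul]
  · rw [← inner_neg_right, hFun_inner hf hg hu (by rwa [norm_neg])]
    refine integral_congr_ae ?_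
    filter_upwards [hae h hv] with ω hω
    rw [hω, mul_neg]

lemma hFun_one (hf : MemLp f ∞ volume) (hg : MemLp g ∞ volume) :
    hFun f g 1 = ∫ x, f x * g x ∂(gaussianMeasure k) := by
  obtain ⟨u, -, hu, -, -⟩ := exists_unit_inner_eq (ρ := 0) (by simp)
  have h1 : ⟪u, u⟫ = 1 := by rw [real_inner_self_eq_norm_sq, hu, one_pow]
  have hu' := measurePreserving_gaussianVec (k := k) hu
  rw [← h1, hFun_inner hf hg hu hu, ← hu'.map_eq, integral_map hu'.measurable.aemeasurable]
  rw [hu'.map_eq]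
  exact (memLp_two_gaussianMeasure hf).1.mul (memLp_two_gaussianMeasure hg).1

lemma continuousOn_hFun (hf : MemLp f ∞ volume) (hg : MemLp g ∞ volume) :
    ContinuousOn (hFun f g) (Icc (-1) 1) := by
  have hs := Orthonormal.summable_abs_inner_mul_inner (orthonormal_hermiteLp (k := k))
    (memLp_two_gaussianMeasure hf).toLp (memLp_two_gaussianMeasure hg).toLp
  simp only [← hermiteCoeff_eq_inner] at hs
  refine continuousOn_tsum (fun α => by fun_prop) hs fun α ρ hρ => ?_
  rw [norm_mul, norm_pow, Real.norm_eq_abs, Real.norm_eq_abs]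
  exact mul_le_of_le_one_right (abs_nonneg _) (pow_le_one₀ (abs_nonneg _) (abs_le.2 hρ))

lemma hRadius_le (hf : MemLp f ∞ volume) (hg : MemLp g ∞ volume) :
    hRadius f g ≤ normInfty f * normInfty g := by
  rw [hRadius, hFun_one hf hg, max_comm, ← abs_eq_max_neg]
  refine abs_integral_le_of_ae_le ?_
  filter_upwards [ae_abs_le_normInfty hf, ae_abs_le_normInfty hg] with x hx hy
  rw [abs_mul]
  exact mul_le_mul hx hy (abs_nonneg _) normInfty_nonneg

lemma IsQuantumCorrelation.mem_Icc {m n : ℕ} {S : Matrix (Fin m) (Fin n) ℝ}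
    (hS : IsQuantumCorrelation S) (i : Fin m) (j : Fin n) : S i j ∈ Icc (-1 : ℝ) 1 := by
  obtain ⟨H, _, _, _, u, v, hu, hv, rfl⟩ := hS
  rw [Set.mem_Icc, ← abs_le]
  simpa [gramMatrix, hu, hv] using abs_real_inner_le_norm (v j) (u i)

end HFun

/-! ## Bounds for the Grothendieck constant -/

section Constant

/-- The CHSH example: the sign matrix has norm at most `2`, since `|a + b| + |a - b| = 2 max(|a|,
|b|)`, while two orthonormal bases at an angle of 45 degrees give the trace `2 * √2`. -/
lemma sqrt_two_le_of_isGrothendieckBound {K : ℝ} (hK : 0 < K) (h : IsGrothendieckBound K) :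
    √2 ≤ K := by
  let A : Matrix (Fin 2) (Fin 2) ℝ := !![1, 1; 1, -1]
  let u : Fin 2 → EuclideanSpace ℝ (Fin 2) := ![!₂[1, 0], !₂[0, 1]]
  let v : Fin 2 → EuclideanSpace ℝ (Fin 2) := ![!₂[(√2)⁻¹, (√2)⁻¹], !₂[(√2)⁻¹, -(√2)⁻¹]]
  have h2 : (√2)⁻¹ ^ 2 + (√2)⁻¹ ^ 2 = (1 : ℝ) := by
    rw [inv_pow, Real.sq_sqrt (by norm_num)]; norm_num
  have h1 := h 2 2 A (EuclideanSpace ℝ (Fin 2)) u v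
    (fun i => by fin_cases i <;> simp [u, EuclideanSpace.norm_eq])
    (fun j => by fin_cases j <;> simpa [v, EuclideanSpace.norm_eq] using h2)
  have hA : normInftyOne A ≤ 2 := by
    refine normInftyOne_le (by norm_num) fun z => ?_
    have hz0 := norm_le_pi_norm z 0
    have hz1 := norm_le_pi_norm z 1
    rw [Real.norm_eq_abs, abs_le] at hz0 hz1
    simp only [A, Matrix.mulVec, dotProduct, Fin.sum_univ_two, Matrix.of_apply, Matrix.cons_val_zero,
      Matrix.cons_val_one, one_mul, neg_mul]
    rcases abs_cases (z 0 + z 1) with h | h <;> rcases abs_cases (z 0 + -z 1) with h' | h' <;>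
      linarith [hz0.1, hz0.2, hz1.1, hz1.2]
  have hval : (A.transpose * gramMatrix u v).trace = 2 * √2 := by
    have h3 : (√2)⁻¹ = √2 / 2 := by
      rw [inv_eq_one_div, div_eq_div_iff (by positivity) (by norm_num),
        Real.mul_self_sqrt (by norm_num)]
      norm_num
    simp [trace_transpose_mul_eq_sum, Fin.sum_univ_two, A, u, v, gramMatrix, PiLp.inner_apply, h3]
    ring
  rw [hval, abs_of_nonneg (by positivity)] at h1
  have h4 := mul_le_mul_of_nonneg_left hA hK.le
  linarith

lemma sqrt_two_le_grothendieckConstant : ((√2 : ℝ) : EReal) ≤ grothendieckConstant := by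
  refine le_sInf ?_
  rintro x ⟨K, hK, hb, rfl⟩
  exact EReal.coe_le_coe_iff.2 (sqrt_two_le_of_isGrothendieckBound hK hb)

lemma isGrothendieckBound_of_dualBound {K : ℝ}
    (h : ∀ {m n : ℕ} {S : Matrix (Fin m) (Fin n) ℝ}, IsQuantumCorrelation S → DualBound S K) :
    IsGrothendieckBound K := fun _ _ A H _ _ _ u v hu hv =>
  h ⟨H, inferInstance, inferInstance, inferInstance, u, v, hu, hv, rfl⟩ A

lemma grothendieckConstant_le {K : ℝ} (hK : 0 < K) (h : IsGrothendieckBound K) :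
    grothendieckConstant ≤ (K : EReal) :=
  sInf_le ⟨K, hK, h, rfl⟩

variable {k : ℕ} {f g : EuclideanSpace ℝ (Fin k) → ℝ} {b : ℕ → ℝ}

/-- If `F` is a power series inverting `h_{f,g}` whose coefficients have total absolute weight one
at `c`, then `r_∞ / c` is admissible in the Grothendieck inequality. -/
lemma isGrothendieckBound_div (hf : MemLp f ∞ volume) (hg : MemLp g ∞ volume)
    {r : ℝ} (himg : hFun f g '' Icc (-1) 1 = Icc (-r) r)
    (hF : ∀ ρ ∈ Icc (-1 : ℝ) 1, ∑' l, b l * hFun f g ρ ^ l = ρ) {c : ℝ} (hc : c ∈ Ioo 0 r)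
    (hb : HasSum (fun l => |b l| * c ^ l) 1) :
    IsGrothendieckBound (normInfty f * normInfty g / c) := by
  refine isGrothendieckBound_of_dualBound fun {_ _ S} hS A => ?_
  -- Part (i) is applied to the matrix `h⁻¹[c S]`, which is a quantum correlation matrix by
  -- Krivine's lemma; `h` maps it back to `c • S`.
  have h1 := dualBound_map_hFun hf hg (hS.map_tsum hc.1.le hb) A
  have h2 : ((S.map fun s => ∑' l, b l * (c * s) ^ l).map (hFun f g)) = c • S := by
    ext i j
    have hs := abs_le.2 (hS.mem_Icc i j)
    have hmem : c * S i j ∈ Icc (-r) r := by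
      rw [Set.mem_Icc, ← abs_le, abs_mul, abs_of_pos hc.1]
      exact (mul_le_of_le_one_right hc.1.le hs).trans hc.2.le
    rw [← himg] at hmem
    obtain ⟨ρ, hρ, hρs⟩ := hmem
    rw [Matrix.map_apply, Matrix.map_apply, ← hρs, hF ρ hρ, hρs]
    rfl
  rw [h2, Matrix.mul_smul, Matrix.trace_smul, smul_eq_mul, abs_mul, abs_of_pos hc.1] at h1
  rw [div_mul_eq_mul_div, le_div_iff₀ hc.1, mul_comm]
  exact h1

/-- Expanding `S` entrywise in powers of `h[S]` and bounding the `l`-th power by `r_∞ ^ l` gives the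
estimate without any change of vectors. -/
lemma isGrothendieckBound_tsum (hf : MemLp f ∞ volume) (hg : MemLp g ∞ volume)
    (hF : ∀ ρ ∈ Icc (-1 : ℝ) 1, HasSum (fun l => b l * hFun f g ρ ^ l) ρ)
    (hs : Summable fun l => |b l| * (normInfty f * normInfty g) ^ l) :
    IsGrothendieckBound (∑' l, |b l| * (normInfty f * normInfty g) ^ l) := by
  refine isGrothendieckBound_of_dualBound fun {_ _ S} hS A => ?_
  have h1 : HasSum (fun l => b l * (A.transpose * S.map fun s => hFun f g s ^ l).trace)
      (A.transpose * S).trace := by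
    simp only [trace_transpose_mul_eq_sum, Matrix.map_apply, Finset.mul_sum]
    refine hasSum_sum fun i _ => hasSum_sum fun j _ => ?_
    simpa only [mul_left_comm] using (hF _ (hS.mem_Icc i j)).mul_left (A i j)
  rw [← h1.tsum_eq, ← tsum_mul_right]
  rw [← Real.norm_eq_abs]
  refine tsum_of_norm_bounded (hs.mul_right _).hasSum fun l => ?_
  rw [norm_mul, Real.norm_eq_abs, Real.norm_eq_abs, mul_assoc]
  exact mul_le_mul_of_nonneg_left (dualBound_map_hFun_pow hf hg hS l A) (abs_nonneg _)

end Constant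

/-! ## The inverse of `h_{f,g}` -/

section Inverse

variable {k : ℕ} {f g : EuclideanSpace ℝ (Fin k) → ℝ}

lemma absFun_eq (ψ : ℝ → ℝ) (x : ℝ) :
    absFun ψ x = ∑' n : ℕ, |iteratedDeriv n ψ 0 / n.factorial| * x ^ n :=
  tsum_congr fun n => by rw [abs_div, Nat.abs_cast]

lemma IsCompletelyRealAnalytic.summable {r : ℝ} {ψ : ℝ → ℝ} (hr : 0 < r)
    (h : IsCompletelyRealAnalytic r ψ) :
    Summable fun n : ℕ => |iteratedDeriv n ψ 0 / n.factorial| * r ^ n := by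
  simpa only [abs_mul, abs_pow, abs_of_pos hr] using h.2

variable (hf : MemLp f ∞ volume) (hg : MemLp g ∞ volume) (hodd : IsOddAE f ∨ IsOddAE g)
  (hinj : InjOn (hFun f g) (Icc (-1) 1))
  (hψ : IsCompletelyRealAnalytic (hRadius f g) (hInv f g))

include hf hg hodd hinj

lemma hRadius_pos : 0 < hRadius f g :=
  max_neg_apply_one_pos (fun _ => hFun_neg hf hg hodd) hinj

lemma mapsTo_hFun : MapsTo (hFun f g) (Icc (-1) 1) (Icc (-hRadius f g) (hRadius f g)) :=
  mapsTo_Icc (continuousOn_hFun hf hg) (fun _ => hFun_neg hf hg hodd) hinj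

lemma image_hFun : hFun f g '' Icc (-1) 1 = Icc (-hRadius f g) (hRadius f g) :=
  image_Icc_eq (continuousOn_hFun hf hg) (fun _ => hFun_neg hf hg hodd) hinj

include hψ

lemma tsum_hInv_hFun {ρ : ℝ} (hρ : ρ ∈ Icc (-1 : ℝ) 1) :
    ∑' n : ℕ, iteratedDeriv n (hInv f g) 0 / n.factorial * hFun f g ρ ^ n = ρ := by
  have hr := hRadius_pos hf hg hodd hinj
  have hs := hψ.summable hr
  have h1 := eqOn_tsum_of_analyticOnNhd hr hψ.1 hs
  have h2 : EqOn (fun ρ => ∑' n : ℕ, iteratedDeriv n (hInv f g) 0 / n.factorial *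
      hFun f g ρ ^ n) id (Ioo (-1) 1) := fun ρ hρ => by
    have h3 := h1 (mapsTo_Ioo (continuousOn_hFun hf hg) (fun _ => hFun_neg hf hg hodd) hinj hρ)
    rw [← h3]
    exact hinj.leftInvOn_invFunOn (Ioo_subset_Icc_self hρ)
  -- Analyticity says nothing at `ρ = ±1`. There the identity follows by density, since the series
  -- converges uniformly on the closed interval `[-r, r]` and `h` is continuous.
  refine h2.of_subset_closure ?_ continuousOn_id Ioo_subset_Icc_self ?_ hρ
  · exact (continuousOn_tsum_mul_pow hs).comp (continuousOn_hFun hf hg)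
      (mapsTo_hFun hf hg hodd hinj)
  · rw [closure_Ioo (by norm_num)]

lemma hasSum_hInv_hFun {ρ : ℝ} (hρ : ρ ∈ Icc (-1 : ℝ) 1) :
    HasSum (fun n : ℕ => iteratedDeriv n (hInv f g) 0 / n.factorial * hFun f g ρ ^ n) ρ := by
  have h := summable_abs_mul_pow (hψ.summable (hRadius_pos hf hg hodd hinj))
    (abs_le.2 (mapsTo_hFun hf hg hodd hinj hρ))
  have h2 : Summable fun n : ℕ =>
      iteratedDeriv n (hInv f g) 0 / n.factorial * hFun f g ρ ^ n :=
    Summable.of_norm (by simpa only [norm_mul, norm_pow, Real.norm_eq_abs] using h)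
  simpa only [tsum_hInv_hFun hf hg hodd hinj hψ hρ] using h2.hasSum

lemma continuousOn_absFun : ContinuousOn (absFun (hInv f g)) (Icc 0 (hRadius f g)) := by
  have hr := hRadius_pos hf hg hodd hinj
  have hs := hψ.summable hr
  simp only [funext (absFun_eq (hInv f g))]
  exact (continuousOn_tsum_mul_pow (by simpa only [abs_abs] using hs)).mono
    (Icc_subset_Icc_left (by linarith))

lemma absFun_zero : absFun (hInv f g) 0 = 0 := by
  have h0 := tsum_hInv_hFun hf hg hodd hinj hψ (ρ := 0) (by simp)
  rw [odd_apply_zero fun _ => hFun_neg hf hg hodd, tsum_eq_single 0 (by simp +contextual)] at h0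
  rw [absFun_eq, tsum_eq_single 0 (by simp +contextual)]
  simpa using h0

lemma strictMonoOn_absFun : StrictMonoOn (absFun (hInv f g)) (Icc 0 (hRadius f g)) := by
  -- Otherwise the series would be constant, yet it reproduces every `ρ` in `[-1, 1]`.
  have hex : ∃ n : ℕ, n ≠ 0 ∧ iteratedDeriv n (hInv f g) 0 / n.factorial ≠ 0 := by
    by_contra! hcon
    have h : ∀ ρ ∈ Icc (-1 : ℝ) 1, iteratedDeriv 0 (hInv f g) 0 / (0 : ℕ).factorial = ρ :=
      fun ρ hρ => by
        have h0 := tsum_hInv_hFun hf hg hodd hinj hψ hρ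
        rw [tsum_eq_single 0 fun n hn => by rw [hcon n hn, zero_mul]] at h0
        simpa using h0
    have h0 := h 0 (by simp)
    have h1 := h 1 (by simp)
    linarith
  obtain ⟨n, hn, hn'⟩ := hex
  simp only [funext (absFun_eq (hInv f g))]
  exact strictMonoOn_tsum_abs_mul_pow (hψ.summable (hRadius_pos hf hg hodd hinj)) hn hn'

lemma existsUnique_absFun_eq {y : ℝ} (hy : 0 < y) (hy' : y ≤ absFun (hInv f g) (hRadius f g)) :
    ∃! x, x ∈ Ioc 0 (hRadius f g) ∧ absFun (hInv f g) x = y := by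
  have hr := hRadius_pos hf hg hodd hinj
  have h0 := absFun_zero hf hg hodd hinj hψ
  have hm := strictMonoOn_absFun hf hg hodd hinj hψ
  obtain ⟨x, hx, hxy⟩ := intermediate_value_Icc hr.le (continuousOn_absFun hf hg hodd hinj hψ)
    (show y ∈ Icc _ _ from ⟨h0.trans_le hy.le, hy'⟩)
  have hx0 : x ≠ 0 := fun h => by
    rw [h, h0] at hxy
    exact hy.ne hxy
  refine ⟨x, ⟨⟨lt_of_le_of_ne hx.1 hx0.symm, hx.2⟩, hxy⟩, fun z hz => ?_⟩
  exact hm.injOn (Ioc_subset_Icc_self hz.1) hx (hz.2.trans hxy.symm)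

lemma existsUnique_absFun_eq_one (h : 1 < absFun (hInv f g) (hRadius f g)) :
    ∃! c, c ∈ Ioo 0 (hRadius f g) ∧ absFun (hInv f g) c = 1 := by
  obtain ⟨c, ⟨hc, hc1⟩, huniq⟩ :=
    existsUnique_absFun_eq hf hg hodd hinj hψ one_pos h.le
  have hne : c ≠ hRadius f g := fun h' => by
    rw [← h', hc1] at h
    exact lt_irrefl _ h
  exact ⟨c, ⟨⟨hc.1, lt_of_le_of_ne hc.2 hne⟩, hc1⟩,
    fun z hz => huniq z ⟨Ioo_subset_Ioc_self hz.1, hz.2⟩⟩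

lemma grothendieckConstant_le_div {c : ℝ} (hc : c ∈ Ioo 0 (hRadius f g))
    (hc1 : absFun (hInv f g) c = 1) :
    grothendieckConstant ≤ ((normInfty f * normInfty g / c : ℝ) : EReal) := by
  have hr := hRadius_pos hf hg hodd hinj
  have hsum : Summable fun n : ℕ => |iteratedDeriv n (hInv f g) 0 / n.factorial| * c ^ n := by
    simpa only [abs_of_pos hc.1] using
      summable_abs_mul_pow (hψ.summable hr) (x := c) (by rw [abs_of_pos hc.1]; exact hc.2.le)
  refine grothendieckConstant_le (div_pos (hr.trans_le (hRadius_le hf hg)) hc.1) ?_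
  refine isGrothendieckBound_div hf hg (image_hFun hf hg hodd hinj)
    (fun ρ => tsum_hInv_hFun hf hg hodd hinj hψ) hc ?_
  rw [absFun_eq] at hc1
  rw [← hc1]
  exact hsum.hasSum

lemma grothendieckConstant_le_absFun (hr : hRadius f g = normInfty f * normInfty g) :
    grothendieckConstant ≤ ((absFun (hInv f g) (hRadius f g) : ℝ) : EReal) := by
  have hpos := hRadius_pos hf hg hodd hinj
  have h0 : 0 < absFun (hInv f g) (hRadius f g) := by
    rw [← absFun_zero hf hg hodd hinj hψ]
    exact strictMonoOn_absFun hf hg hodd hinj hψ ⟨le_rfl, hpos.le⟩ ⟨hpos.le, le_rfl⟩ hpos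
  refine grothendieckConstant_le h0 ?_
  rw [absFun_eq, hr]
  refine isGrothendieckBound_tsum hf hg (fun ρ => hasSum_hInv_hFun hf hg hodd hinj hψ) ?_
  rw [← hr]
  exact hψ.summable hpos

end Inverse

end GrothendieckKrivine

end

theorem mainTheorem1 (k m n : ℕ) (f g : EuclideanSpace ℝ (Fin k) → ℝ)
    (hf : MemLp f ∞ volume) (hg : MemLp g ∞ volume) :
    -- the inequalities for quantum correlation matrices and for correlation matrices
    ((∀ A S : Matrix (Fin m) (Fin n) ℝ, IsQuantumCorrelation S →
        |(A.transpose * S.map (hFun f g)).trace| ≤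
          normInfty f * normInfty g * normInftyOne A) ∧
      (∀ A S : Matrix (Fin n) (Fin n) ℝ, IsCorrelation S →
        ∃ M : ℝ,
          IsGreatest ((fun x : Fin n → ℝ => |x ⬝ᵥ A.mulVec x|) ''
            {x | ∀ i, x i ∈ Icc (-1 : ℝ) 1}) M ∧
          |(A.transpose * S.map (hFun f f)).trace| ≤ normInfty f ^ 2 * M)) ∧
    -- the case where `f` or `g` is odd and `h_{f,g}` is injective
    ((IsOddAE f ∨ IsOddAE g) → InjOn (hFun f g) (Icc (-1) 1) →
      -- topological properties of `h_{f,g}`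
      ((∃ e : Icc (-1 : ℝ) 1 ≃ₜ Icc (-hRadius f g) (hRadius f g),
          ∀ ρ : Icc (-1 : ℝ) 1, (e ρ : ℝ) = hFun f g ρ) ∧
        (StrictMonoOn (hFun f g) (Icc (-1) 1) ∨ StrictAntiOn (hFun f g) (Icc (-1) 1)) ∧
        hFun f g '' Icc (-1) 1 = Icc (-hRadius f g) (hRadius f g) ∧
        hRadius f g = max (-∫ x, f x * g x ∂(gaussianMeasure k))
          (∫ x, f x * g x ∂(gaussianMeasure k)) ∧
        0 < hRadius f g ∧
        hRadius f g ≤ normInfty f * normInfty g) ∧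
      (IsCompletelyRealAnalytic (hRadius f g) (hInv f g) →
        -- the upper bound through the root of `(h_{f,g}⁻¹)_abs = 1`
        (1 < absFun (hInv f g) (hRadius f g) →
          (∃! c : ℝ, c ∈ Ioo 0 (hRadius f g) ∧ absFun (hInv f g) c = 1) ∧
          ∀ c ∈ Ioo 0 (hRadius f g), absFun (hInv f g) c = 1 →
            grothendieckConstant ≤ ((normInfty f * normInfty g / c : ℝ) : EReal)) ∧
        -- the case `r = r_∞`
        (hRadius f g = normInfty f * normInfty g →
          1 < absFun (hInv f g) (hRadius f g) ∧
          (∃! c : ℝ, c ∈ Ioo 0 (hRadius f g) ∧ absFun (hInv f g) c = 1) ∧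
          (∃! γ : ℝ, γ ∈ Ioc 0 (hRadius f g) ∧
            grothendieckConstant = ((absFun (hInv f g) γ : ℝ) : EReal)) ∧
          ∀ c ∈ Ioo 0 (hRadius f g), absFun (hInv f g) c = 1 →
            grothendieckConstant ≤
              ((min (hRadius f g / c) (absFun (hInv f g) (hRadius f g)) : ℝ) : EReal)))) := by
  refine ⟨⟨fun A S hS => dualBound_map_hFun hf hg hS A,
    exists_isGreatest_and_abs_trace_le hf⟩, fun hodd hinj => ⟨?_, fun hψ => ⟨fun h1 => ?_, ?_⟩⟩⟩
  · have hc := continuousOn_hFun hf hg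
    have hneg : ∀ ρ ∈ Icc (-1 : ℝ) 1, hFun f g (-ρ) = -hFun f g ρ := fun _ => hFun_neg hf hg hodd
    refine ⟨exists_homeomorph hc hneg hinj, strictMonoOn_or_strictAntiOn hc hinj,
      image_hFun hf hg hodd hinj, ?_, hRadius_pos hf hg hodd hinj, hRadius_le hf hg⟩
    rw [hRadius, hFun_one hf hg]
  · exact ⟨existsUnique_absFun_eq_one hf hg hodd hinj hψ h1,
      fun c => grothendieckConstant_le_div hf hg hodd hinj hψ⟩
  · intro hr
    have hle := grothendieckConstant_le_absFun hf hg hodd hinj hψ hr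
    have hge := sqrt_two_le_grothendieckConstant
    -- The chain is `1 < √2 ≤ K_G ≤ a(r)`, where the last inequality is the direct series bound,
    -- available because `r = r_∞`.
    have h1 : 1 < absFun (hInv f g) (hRadius f g) :=
      Real.one_lt_sqrt_two.trans_le (EReal.coe_le_coe_iff.1 (hge.trans hle))
    refine ⟨h1, existsUnique_absFun_eq_one hf hg hodd hinj hψ h1, ?_, fun c hc hc1 => ?_⟩
    -- The two bounds make the extended-real infimum finite, so `K_G` is a real number in `(0,
    -- a(r)]` and is attained by `a` exactly once.
    · obtain ⟨K, hK⟩ : ∃ K : ℝ, grothendieckConstant = (K : EReal) :=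
        ⟨_, (EReal.coe_toReal (hle.trans_lt (EReal.coe_lt_top _)).ne
          ((EReal.bot_lt_coe _).trans_le hge).ne').symm⟩
      rw [hK] at hle hge ⊢
      obtain ⟨γ, ⟨hγ, hγK⟩, huniq⟩ := existsUnique_absFun_eq hf hg hodd hinj hψ
        ((Real.sqrt_pos.2 two_pos).trans_le (EReal.coe_le_coe_iff.1 hge))
        (EReal.coe_le_coe_iff.1 hle)
      exact ⟨γ, ⟨hγ, by rw [hγK]⟩, fun z hz => huniq z ⟨hz.1, (EReal.coe_injective hz.2).symm⟩⟩
    · have h2 := grothendieckConstant_le_div hf hg hodd hinj hψ hc hc1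
      rw [← hr] at h2
      rw [EReal.coe_strictMono.monotone.map_min]
      exact le_min h2 hle
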